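/- Rings are associative with unit, not necessarily commutative. Let $(\mathcal C,\Delta_{\mathcal C},\varepsilon_{\mathcal C})$ be an $R$-coring and $(\mathcal D,\Delta_{\mathcal D},\varepsilon_{\mathcal D})$ an $S$-coring, i.e. comonoids in the monoidal categories of $R$-bimodules and of $S$-bimodules; write $\Delta_{\mathcal C}(c)=c_{(1)}\otimes_R c_{(2)}$ (summation understood). Let $(\Phi,\varphi)$ be a homomorphism of corings from $\mathcal C$ to $\mathcal D$: $\varphi:R\to S$ is a ring homomorphism, $\Phi:\mathcal C\to\mathcal D$ is additive with $\Phi(rcr')=\varphi(r)\Phi(c)\varphi(r')$, and $\Delta_{\mathcal D}(\Phi(c))=\Phi(c_{(1)})\otimes_S\Phi(c_{(2)})$, $\varepsilon_{\mathcal D}(\Phi(c))=\varphi(\varepsilon_{\mathcal C}(c))$. Regard $S$ as an $R$-bimodule through $\varphi$. Let $\mathcal M^{\mathcal C}_R$ and $\mathcal M^{\mathcal D}_S$ be the categories of right $\mathcal C$-comodules and of right $\mathcal D$-comodules, with colinear maps. The $(S,R)$-bimodule $S\otimes_R\mathcal C$ has the left $\mathcal D$-coaction ${}^{\mathcal D}\rho(s\otimes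 c)=s\Phi(c_{(1)})\otimes_S(1\otimes_R c_{(2)})$ and the right $\mathcal C$-coaction $S\otimes_R\Delta_{\mathcal C}$. For a right $\mathcal D$-comodule $(N,\rho_N)$ let $N\square_{\mathcal D}(S\otimes_R\mathcal C)$, with inclusion $i_N$ into $N\otimes_S(S\otimes_R\mathcal C)$, be the equalizer of the two right $R$-linear maps $$\rho_N\otimes_S(S\otimes_R\mathcal C),\quad N\otimes_S{}^{\mathcal D}\rho\;:\;\; N\otimes_S(S\otimes_R\mathcal C)\longrightarrow N\otimes_S\mathcal D\otimes_S(S\otimes_R\mathcal C).$$ A left $R$-module $M$ is said to preserve this equalizer if $i_N\otimes_R M$ is the equalizer of the two maps obtained by applying $-\otimes_R M$. **Theorem.** Assume that the left $R$-modules ${}_RS$ and ${}_R(\mathcal C\otimes_R\mathcal C)$ preserve the above equalizer for every $N\in\mathcal M^{\mathcal D}_S$. (The second assumption implies that ${}_R\mathcal C$ preserves it too, and that $N\square_{\mathcal D}(S\otimes_R\mathcal C)$ is a right $\mathcal C$-comodule with the unique coaction for which $i_N$ is colinear, where $N\otimes_S(S\otimes_R\mathcal C)$ has the coaction $N\otimes_S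 S\otimes_R\Delta_{\mathcal C}$.) Then the following are equivalent. 1. The coinduction functor $G=-\square_{\mathcal D}(S\otimes_R\mathcal C):\mathcal M^{\mathcal D}_S\to\mathcal M^{\mathcal C}_R$ is naturally full, i.e. there are maps $P_{N,N'}:\mathrm{Hom}(GN,GN')\to\mathrm{Hom}(N,N')$, natural in $N$ and $N'$, such that $G(P_{N,N'}(g))=g$ for all $g:GN\to GN'$. 2. The $\mathcal D$-bicomodule map $\hat\Phi:S\otimes_R\mathcal C\otimes_R S\to\mathcal D$, $\hat\Phi(s\otimes c\otimes s')=s\Phi(c)s'$, is a split monomorphism of $\mathcal D$-bicomodules: there is a homomorphism of $\mathcal D$-bicomodules $\hat\Psi:\mathcal D\to S\otimes_R\mathcal C\otimes_R S$ with $\hat\Psi\circ\hat\Phi=\mathrm{id}_{S\otimes_R\mathcal C\otimes_R S}$. Here $\mathcal D$ has both coactions equal to $\Delta_{\mathcal D}$, and $S\otimes_R\mathcal C\otimes_R S$ has the coactions $s\otimes c\otimes s'\mapsto s\Phi(c_{(1)})\otimes_S(1\otimes c_{(2)}\otimes s')$ and $s\otimes c\otimes s'\mapsto(s\otimes c_{(1)}\otimes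 1)\otimes_S\Phi(c_{(2)})s'$. -/

import Mathlib

open CategoryTheory MulOpposite

universe u

namespace Corings

/-! Conventions. Rings are associative and unital, not necessarily commutative. A right `R`-module
is a module over `Rᵐᵒᵖ`, so `op r • m` is the element usually written `m r`. An `(R, S)`-bimodule
carries `Module R M`, `Module Sᵐᵒᵖ M` and `SMulCommClass R Sᵐᵒᵖ M`. -/

section Tensor

/-- The relations `(m r) ⊗ n = m ⊗ (r n)` inside the tensor product over `ℤ`. -/
def balancedRel (R M N : Type u) [Ring R] [AddCommGroup M] [Module Rᵐᵒᵖ M]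
    [AddCommGroup N] [Module R N] : AddSubgroup (TensorProduct ℤ M N) :=
  AddSubgroup.closure {z | ∃ (m : M) (r : R) (n : N),
    z = TensorProduct.tmul ℤ (op r • m) n - TensorProduct.tmul ℤ m (r • n)}

/-- The tensor product `M ⊗_R N` of a right and a left module over a ring `R`. -/
def BTensor (R M N : Type u) [Ring R] [AddCommGroup M] [Module Rᵐᵒᵖ M]
    [AddCommGroup N] [Module R N] : Type u :=
  TensorProduct ℤ M N ⧸ balancedRel R M N

variable {R S T M M₁ M₂ N N₁ N₂ P Q : Type u} [Ring R] [Ring S] [Ring T]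
variable [AddCommGroup M] [AddCommGroup M₁] [AddCommGroup M₂]
variable [AddCommGroup N] [AddCommGroup N₁] [AddCommGroup N₂]
variable [AddCommGroup P] [AddCommGroup Q]

namespace BTensor

instance instAddCommGroup [Module Rᵐᵒᵖ M] [Module R N] : AddCommGroup (BTensor R M N) :=
  inferInstanceAs (AddCommGroup (TensorProduct ℤ M N ⧸ balancedRel R M N))

section basic

variable [Module Rᵐᵒᵖ M] [Module Rᵐᵒᵖ M₁] [Module Rᵐᵒᵖ M₂]
variable [Module R N] [Module R N₁] [Module R N₂]

variable (R) in
/-- The pure tensor `m ⊗_R n`. -/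
def tmul (m : M) (n : N) : BTensor R M N :=
  QuotientAddGroup.mk' (balancedRel R M N) (TensorProduct.tmul ℤ m n)

theorem add_tmul (m m' : M) (n : N) : tmul R (m + m') n = tmul R m n + tmul R m' n := by
  simp only [tmul, TensorProduct.add_tmul, map_add]; rfl

theorem tmul_add (m : M) (n n' : N) : tmul R m (n + n') = tmul R m n + tmul R m n' := by
  simp only [tmul, TensorProduct.tmul_add, map_add]; rfl

theorem smul_tmul (r : R) (m : M) (n : N) : tmul R (op r • m) n = tmul R m (r • n) := by
  refine (QuotientAddGroup.eq_iff_sub_mem).2 ?_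
  exact AddSubgroup.subset_closure ⟨m, r, n, rfl⟩

@[simp] theorem zero_tmul (n : N) : tmul R (0 : M) n = 0 := by
  have h := add_tmul (R := R) (0 : M) 0 n
  rw [add_zero] at h
  exact left_eq_add.1 h

@[simp] theorem tmul_zero (m : M) : tmul R m (0 : N) = 0 := by
  have h := tmul_add (R := R) m (0 : N) 0
  rw [add_zero] at h
  exact left_eq_add.1 h

theorem induction_on {p : BTensor R M N → Prop} (x : BTensor R M N) (zero : p 0)
    (tmul : ∀ m n, p (tmul R m n)) (add : ∀ x y, p x → p y → p (x + y)) : p x := by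
  obtain ⟨y, rfl⟩ := QuotientAddGroup.mk_surjective x
  induction y using TensorProduct.induction_on with
  | zero => exact zero
  | tmul m n => exact tmul m n
  | add a b ha hb => exact add _ _ ha hb

/-- The additive map out of `M ⊗_R N` given by a biadditive balanced map. -/
def lift (f : M →+ N →+ P) (h : ∀ (r : R) (m : M) (n : N), f (op r • m) n = f m (r • n)) :
    BTensor R M N →+ P :=
  QuotientAddGroup.lift (balancedRel R M N)
    (TensorProduct.liftAddHom f (fun r m n => by simp)) (by
      rw [balancedRel, AddSubgroup.closure_le]
      rintro _ ⟨m, r, n, rfl⟩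
      change TensorProduct.liftAddHom f _ (_ - _) = 0
      rw [map_sub, TensorProduct.liftAddHom_tmul, TensorProduct.liftAddHom_tmul, h, sub_self])

@[simp] theorem lift_tmul (f : M →+ N →+ P)
    (h : ∀ (r : R) (m : M) (n : N), f (op r • m) n = f m (r • n)) (m : M) (n : N) :
    lift f h (tmul R m n) = f m n := rfl

theorem hom_ext {f g : BTensor R M N →+ P} (h : ∀ m n, f (tmul R m n) = g (tmul R m n)) :
    f = g := by
  ext x
  induction x using induction_on with
  | zero => simp
  | tmul m n => exact h m n
  | add x y hx hy => rw [map_add, map_add, hx, hy]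

variable (R) in
/-- Pure tensors as a biadditive map. -/
def mk : M →+ N →+ BTensor R M N :=
  AddMonoidHom.mk' (fun m => AddMonoidHom.mk' (fun n => tmul R m n) (tmul_add m))
    (fun m m' => by ext n; exact add_tmul m m' n)

@[simp] theorem mk_apply (m : M) (n : N) : mk R m n = tmul R m n := rfl

/-- The additive map `f ⊗_R g`. -/
def map (f : M →ₗ[Rᵐᵒᵖ] M₁) (g : N →ₗ[R] N₁) : BTensor R M N →+ BTensor R M₁ N₁ :=
  lift (((mk R).comp f.toAddMonoidHom).compl₂ g.toAddMonoidHom)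
    (fun r m n => by
      change tmul R (f (op r • m)) (g n) = tmul R (f m) (g (r • n))
      rw [map_smul, map_smul, smul_tmul])

@[simp] theorem map_tmul (f : M →ₗ[Rᵐᵒᵖ] M₁) (g : N →ₗ[R] N₁) (m : M) (n : N) :
    map f g (tmul R m n) = tmul R (f m) (g n) := rfl

theorem map_map (f' : M₁ →ₗ[Rᵐᵒᵖ] M₂) (g' : N₁ →ₗ[R] N₂) (f : M →ₗ[Rᵐᵒᵖ] M₁)
    (g : N →ₗ[R] N₁) (x : BTensor R M N) :
    map f' g' (map f g x) = map (f'.comp f) (g'.comp g) x := by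
  induction x using induction_on with
  | zero => simp
  | tmul m n => rfl
  | add x y hx hy => simp only [map_add, hx, hy]

theorem map_id (x : BTensor R M N) :
    map (LinearMap.id : M →ₗ[Rᵐᵒᵖ] M) (LinearMap.id : N →ₗ[R] N) x = x := by
  induction x using induction_on with
  | zero => simp
  | tmul m n => rfl
  | add x y hx hy => simp only [map_add, hx, hy]

end basic

section actions

/-- If `M` is a `(T, R)`-bimodule, then `M ⊗_R N` is a left `T`-module. -/
instance instModuleLeft [Module Rᵐᵒᵖ M] [Module R N] [Module T M] [SMulCommClass T Rᵐᵒᵖ M] :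
    Module T (BTensor R M N) where
  smul t x := map
    { toFun := fun m => t • m
      map_add' := smul_add t
      map_smul' := fun r m => smul_comm t r m } LinearMap.id x
  one_smul x := by
    change map _ _ x = x
    induction x using induction_on with
    | zero => simp
    | tmul m n => simp
    | add x y hx hy => simp only [map_add, hx, hy]
  mul_smul a b x := by
    change map _ _ x = map _ _ (map _ _ x)
    induction x using induction_on with
    | zero => simp
    | tmul m n => simp [mul_smul]
    | add x y hx hy => simp only [map_add, hx, hy]
  smul_zero a := map_zero _
  smul_add a x y := map_add _ x y
  add_smul a b x := by
    change map _ _ x = map _ _ x + map _ _ x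
    induction x using induction_on with
    | zero => simp
    | tmul m n => simp [add_smul, add_tmul]
    | add x y hx hy => simp only [map_add, hx, hy]; abel
  zero_smul x := by
    change map _ _ x = 0
    induction x using induction_on with
    | zero => simp
    | tmul m n => simp
    | add x y hx hy => simp only [map_add, hx, hy, add_zero]

/-- If `N` is an `(R, T)`-bimodule, then `M ⊗_R N` is a right `T`-module. -/
instance instModuleRight [Module Rᵐᵒᵖ M] [Module R N] [Module Tᵐᵒᵖ N] [SMulCommClass R Tᵐᵒᵖ N] :
    Module Tᵐᵒᵖ (BTensor R M N) where
  smul t x := map LinearMap.id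
    { toFun := fun n => t • n
      map_add' := smul_add t
      map_smul' := fun r n => (smul_comm r t n).symm } x
  one_smul x := by
    change map _ _ x = x
    induction x using induction_on with
    | zero => simp
    | tmul m n => simp
    | add x y hx hy => simp only [map_add, hx, hy]
  mul_smul a b x := by
    change map _ _ x = map _ _ (map _ _ x)
    induction x using induction_on with
    | zero => simp
    | tmul m n => simp [mul_smul]
    | add x y hx hy => simp only [map_add, hx, hy]
  smul_zero a := map_zero _
  smul_add a x y := map_add _ x y
  add_smul a b x := by
    change map _ _ x = map _ _ x + map _ _ x
    induction x using induction_on with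
    | zero => simp
    | tmul m n => simp [add_smul, tmul_add]
    | add x y hx hy => simp only [map_add, hx, hy]; abel
  zero_smul x := by
    change map _ _ x = 0
    induction x using induction_on with
    | zero => simp
    | tmul m n => simp
    | add x y hx hy => simp only [map_add, hx, hy, add_zero]

@[simp] theorem left_smul_tmul [Module Rᵐᵒᵖ M] [Module R N] [Module T M] [SMulCommClass T Rᵐᵒᵖ M]
    (t : T) (m : M) (n : N) : t • tmul R m n = tmul R (t • m) n := rfl

@[simp] theorem right_smul_tmul [Module Rᵐᵒᵖ M] [Module R N] [Module Tᵐᵒᵖ N]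
    [SMulCommClass R Tᵐᵒᵖ N] (t : Tᵐᵒᵖ) (m : M) (n : N) :
    t • tmul R m n = tmul R m (t • n) := rfl

instance instSMulCommClass [Module Rᵐᵒᵖ M] [Module R N] [Module S M] [SMulCommClass S Rᵐᵒᵖ M]
    [Module Tᵐᵒᵖ N] [SMulCommClass R Tᵐᵒᵖ N] : SMulCommClass S Tᵐᵒᵖ (BTensor R M N) where
  smul_comm s t x := by
    induction x using induction_on with
    | zero => simp only [smul_zero]
    | tmul m n => simp
    | add x y hx hy => simp only [smul_add, hx, hy]

end actions

section assoc

variable [Module Rᵐᵒᵖ M] [Module R N] [Module Sᵐᵒᵖ N] [SMulCommClass R Sᵐᵒᵖ N] [Module S P]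

/-- The biadditive map `(m ⊗ n, p) ↦ m ⊗ (n ⊗ p)`. -/
def assocAux : BTensor R M N →+ P →+ BTensor R M (BTensor S N P) :=
  lift (AddMonoidHom.mk' (fun m => AddMonoidHom.mk'
      (fun n => (mk R m).comp (mk S n))
      (fun n n' => by ext p; simp [tmul_add]))
      (fun m m' => by ext n p; simp))
    (fun r m n => by
      ext p
      change tmul R (op r • m) (tmul S n p) = tmul R m (tmul S (r • n) p)
      rw [smul_tmul, left_smul_tmul])

theorem assocAux_tmul (m : M) (n : N) (p : P) :
    assocAux (S := S) (tmul R m n) p = tmul R m (tmul S n p) := rfl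

theorem assocAux_smul (s : S) (x : BTensor R M N) (p : P) :
    assocAux (S := S) (op s • x) p = assocAux x (s • p) := by
  induction x using induction_on with
  | zero => rw [smul_zero, map_zero, AddMonoidHom.zero_apply, AddMonoidHom.zero_apply]
  | tmul m n => rw [right_smul_tmul, assocAux_tmul, assocAux_tmul, smul_tmul]
  | add x y hx hy => rw [smul_add, map_add, map_add, AddMonoidHom.add_apply,
      AddMonoidHom.add_apply, hx, hy]

/-- The canonical map `(M ⊗_R N) ⊗_S P → M ⊗_R (N ⊗_S P)`. -/
def assocHom : BTensor S (BTensor R M N) P →+ BTensor R M (BTensor S N P) :=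
  lift assocAux assocAux_smul

/-- The canonical map `M ⊗_R (N ⊗_S P) → (M ⊗_R N) ⊗_S P`. -/
def assocInvHom : BTensor R M (BTensor S N P) →+ BTensor S (BTensor R M N) P :=
  lift (AddMonoidHom.mk' (fun m => lift (AddMonoidHom.mk'
      (fun n => AddMonoidHom.mk' (fun p => tmul S (tmul R m n) p)
        (fun p p' => by rw [tmul_add]))
      (fun n n' => by ext p; simp [add_tmul, tmul_add]))
      (fun s n p => by
        change tmul S (tmul R m (op s • n)) p = tmul S (tmul R m n) (s • p)
        rw [← right_smul_tmul, smul_tmul]))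
      (fun m m' => hom_ext (fun n p => by simp [add_tmul])))
    (fun r m x => by
      induction x using induction_on with
      | zero => simp
      | tmul n p => simp [smul_tmul]
      | add x y hx hy => simp only [smul_add, map_add, hx, hy])

/-- The associativity isomorphism `(M ⊗_R N) ⊗_S P ≃ M ⊗_R (N ⊗_S P)`. -/
def assoc : BTensor S (BTensor R M N) P ≃+ BTensor R M (BTensor S N P) :=
  AddMonoidHom.toAddEquiv assocHom assocInvHom
    (by
      refine hom_ext fun x p => ?_
      induction x using induction_on with
      | zero => simp
      | tmul m n => rfl
      | add x y hx hy => simp only [add_tmul, map_add, hx, hy])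
    (by
      refine hom_ext fun m x => ?_
      induction x using induction_on with
      | zero => simp
      | tmul n p => rfl
      | add x y hx hy => simp only [tmul_add, map_add, hx, hy])

@[simp] theorem assoc_tmul (m : M) (n : N) (p : P) :
    assoc (tmul S (tmul R m n) p) = tmul R m (tmul S n p) := rfl

@[simp] theorem assoc_symm_tmul (m : M) (n : N) (p : P) :
    assoc.symm (tmul R m (tmul S n p)) = tmul S (tmul R m n) p := rfl

theorem assoc_op_smul [Module Tᵐᵒᵖ P] [SMulCommClass S Tᵐᵒᵖ P] (t : Tᵐᵒᵖ)
    (x : BTensor S (BTensor R M N) P) : assoc (t • x) = t • assoc x := by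
  induction x using induction_on with
  | zero => rw [smul_zero, map_zero, smul_zero]
  | add x y hx hy => rw [smul_add, map_add, map_add, smul_add, hx, hy]
  | tmul x p =>
    induction x using induction_on with
    | zero => rw [zero_tmul, smul_zero, map_zero, smul_zero]
    | add x y hx hy => rw [add_tmul, smul_add, map_add, map_add, smul_add, hx, hy]
    | tmul m n => rfl

theorem assoc_smul [Module T M] [SMulCommClass T Rᵐᵒᵖ M] (t : T)
    (x : BTensor S (BTensor R M N) P) : assoc (t • x) = t • assoc x := by
  induction x using induction_on with
  | zero => rw [smul_zero, map_zero, smul_zero]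
  | add x y hx hy => rw [smul_add, map_add, map_add, smul_add, hx, hy]
  | tmul x p =>
    induction x using induction_on with
    | zero => rw [zero_tmul, smul_zero, map_zero, smul_zero]
    | add x y hx hy => rw [add_tmul, smul_add, map_add, map_add, smul_add, hx, hy]
    | tmul m n => rfl

theorem assoc_symm_op_smul [Module Tᵐᵒᵖ P] [SMulCommClass S Tᵐᵒᵖ P] (t : Tᵐᵒᵖ)
    (x : BTensor R M (BTensor S N P)) : assoc.symm (t • x) = t • assoc.symm x := by
  apply assoc.injective
  rw [assoc_op_smul, AddEquiv.apply_symm_apply, AddEquiv.apply_symm_apply]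

theorem assoc_symm_smul [Module T M] [SMulCommClass T Rᵐᵒᵖ M] (t : T)
    (x : BTensor R M (BTensor S N P)) : assoc.symm (t • x) = t • assoc.symm x := by
  apply assoc.injective
  rw [assoc_smul, AddEquiv.apply_symm_apply, AddEquiv.apply_symm_apply]

end assoc

section mapSmul

variable [Module Rᵐᵒᵖ M] [Module Rᵐᵒᵖ M₁] [Module R N] [Module R N₁]

theorem map_smul' [Module T M] [SMulCommClass T Rᵐᵒᵖ M] [Module T M₁] [SMulCommClass T Rᵐᵒᵖ M₁]
    (f : M →ₗ[Rᵐᵒᵖ] M₁) (g : N →ₗ[R] N₁) (t : T) (hf : ∀ m, f (t • m) = t • f m)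
    (x : BTensor R M N) : map f g (t • x) = t • map f g x := by
  induction x using induction_on with
  | zero => rw [smul_zero, map_zero, smul_zero]
  | tmul m n => rw [left_smul_tmul, map_tmul, map_tmul, left_smul_tmul, hf]
  | add x y hx hy => rw [smul_add, map_add, map_add, smul_add, hx, hy]

theorem map_op_smul' [Module Tᵐᵒᵖ N] [SMulCommClass R Tᵐᵒᵖ N] [Module Tᵐᵒᵖ N₁]
    [SMulCommClass R Tᵐᵒᵖ N₁] (f : M →ₗ[Rᵐᵒᵖ] M₁) (g : N →ₗ[R] N₁) (t : Tᵐᵒᵖ)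
    (hg : ∀ n, g (t • n) = t • g n)
    (x : BTensor R M N) : map f g (t • x) = t • map f g x := by
  induction x using induction_on with
  | zero => rw [smul_zero, map_zero, smul_zero]
  | tmul m n => rw [right_smul_tmul, map_tmul, map_tmul, right_smul_tmul, hg]
  | add x y hx hy => rw [smul_add, map_add, map_add, smul_add, hx, hy]

end mapSmul

section unit

/-- The canonical map `R ⊗_R N → N`, `r ⊗ n ↦ r n`. -/
def lid (R N : Type u) [Ring R] [AddCommGroup N] [Module R N] : BTensor R R N →+ N :=
  lift (AddMonoidHom.mk' (fun r => AddMonoidHom.mk' (fun n => r • n) (smul_add r))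
    (fun r r' => by ext n; exact add_smul r r' n))
    (fun r m n => by
      change (m * r) • n = m • r • n
      rw [mul_smul])

/-- The canonical map `M ⊗_R R → M`, `m ⊗ r ↦ m r`. -/
def rid (R M : Type u) [Ring R] [AddCommGroup M] [Module Rᵐᵒᵖ M] : BTensor R M R →+ M :=
  lift (AddMonoidHom.mk' (fun m => AddMonoidHom.mk' (fun r : R => op r • m)
      (fun r r' => by rw [MulOpposite.op_add, add_smul]))
    (fun m m' => by ext r; exact smul_add _ m m'))
    (fun r m n => by
      change op n • op r • m = op (r * n) • m
      rw [MulOpposite.op_mul, mul_smul])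

@[simp] theorem lid_tmul [Module R N] (r : R) (n : N) : lid R N (tmul R r n) = r • n := rfl

@[simp] theorem rid_tmul [Module Rᵐᵒᵖ M] (m : M) (r : R) :
    rid R M (tmul R m r) = op r • m := rfl

end unit

end BTensor

end Tensor

open BTensor

section BimodHom

variable {R S T M N P : Type u} [Ring R] [Ring S] [Ring T]
variable [AddCommGroup M] [AddCommGroup N] [AddCommGroup P]
variable [Module R M] [Module Sᵐᵒᵖ M] [Module R N] [Module Sᵐᵒᵖ N] [Module R P] [Module Sᵐᵒᵖ P]

/-- Homomorphisms of `(R, S)`-bimodules. -/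
structure BimodHom (R S M N : Type u) [Ring R] [Ring S] [AddCommGroup M] [AddCommGroup N]
    [Module R M] [Module Sᵐᵒᵖ M] [Module R N] [Module Sᵐᵒᵖ N] extends M →+ N where
  map_smul' : ∀ (r : R) (m : M), toFun (r • m) = r • toFun m
  map_op_smul' : ∀ (s : Sᵐᵒᵖ) (m : M), toFun (s • m) = s • toFun m

namespace BimodHom

instance : FunLike (BimodHom R S M N) M N where
  coe f := f.toFun
  coe_injective f g h := by
    obtain ⟨f, _, _⟩ := f
    obtain ⟨g, _, _⟩ := g
    congr
    exact DFunLike.coe_injective h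

instance : AddMonoidHomClass (BimodHom R S M N) M N where
  map_add f := f.map_add'
  map_zero f := f.map_zero'

@[ext] theorem ext {f g : BimodHom R S M N} (h : ∀ m, f m = g m) : f = g := DFunLike.ext _ _ h

theorem map_smul (f : BimodHom R S M N) (r : R) (m : M) : f (r • m) = r • f m := f.map_smul' r m

theorem map_op_smul (f : BimodHom R S M N) (s : Sᵐᵒᵖ) (m : M) : f (s • m) = s • f m :=
  f.map_op_smul' s m

/-- The underlying homomorphism of left modules. -/
def left (f : BimodHom R S M N) : M →ₗ[R] N where
  toFun := f
  map_add' := map_add f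
  map_smul' := f.map_smul

/-- The underlying homomorphism of right modules. -/
def right (f : BimodHom R S M N) : M →ₗ[Sᵐᵒᵖ] N where
  toFun := f
  map_add' := map_add f
  map_smul' := f.map_op_smul

@[simp] theorem left_apply (f : BimodHom R S M N) (m : M) : f.left m = f m := rfl

@[simp] theorem right_apply (f : BimodHom R S M N) (m : M) : f.right m = f m := rfl

/-- Identity homomorphism. -/
def id : BimodHom R S M M where
  toAddMonoidHom := AddMonoidHom.id M
  map_smul' _ _ := rfl
  map_op_smul' _ _ := rfl

/-- Composition of bimodule homomorphisms. -/
def comp (g : BimodHom R S N P) (f : BimodHom R S M N) : BimodHom R S M P where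
  toAddMonoidHom := g.toAddMonoidHom.comp f.toAddMonoidHom
  map_smul' r m := by
    change g (f (r • m)) = r • g (f m)
    rw [f.map_smul, g.map_smul]
  map_op_smul' s m := by
    change g (f (s • m)) = s • g (f m)
    rw [f.map_op_smul, g.map_op_smul]

@[simp] theorem id_apply (m : M) : (id : BimodHom R S M M) m = m := rfl

@[simp] theorem comp_apply (g : BimodHom R S N P) (f : BimodHom R S M N) (m : M) :
    g.comp f m = g (f m) := rfl

end BimodHom

end BimodHom

/-- An `R`-coring structure on the `R`-bimodule `C`: a coassociative comultiplication with a
counit, both `R`-bimodule maps. -/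
class Coring (R C : Type u) [Ring R] [AddCommGroup C] [Module R C] [Module Rᵐᵒᵖ C]
    [SMulCommClass R Rᵐᵒᵖ C] where
  comul : BimodHom R R C (BTensor R C C)
  counit : BimodHom R R C R
  coassoc : ∀ c : C, assoc (map comul.right LinearMap.id (comul c)) =
    map LinearMap.id comul.left (comul c)
  counit_comul : ∀ c : C, lid R C (map counit.right LinearMap.id (comul c)) = c
  comul_counit : ∀ c : C, rid R C (map LinearMap.id counit.left (comul c)) = c

open Coring

section Comodule

variable (R C : Type u) [Ring R] [AddCommGroup C] [Module R C] [Module Rᵐᵒᵖ C]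
  [SMulCommClass R Rᵐᵒᵖ C] [Coring R C]

/-- A right comodule over the `R`-coring `C`. -/
structure RightComodule where
  carrier : Type u
  [addCommGroup : AddCommGroup carrier]
  [module : Module Rᵐᵒᵖ carrier]
  coact : carrier →ₗ[Rᵐᵒᵖ] BTensor R carrier C
  coassoc : ∀ m, assoc (map coact LinearMap.id (coact m)) =
    map LinearMap.id (comul (R := R) (C := C)).left (coact m)
  coact_counit : ∀ m, rid R carrier
    (map LinearMap.id (counit (R := R) (C := C)).left (coact m)) = m

attribute [instance] RightComodule.addCommGroup RightComodule.module

variable {R C}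

/-- Right colinear maps. -/
@[ext] structure RightComodule.Hom (M N : RightComodule R C) where
  toLin : M.carrier →ₗ[Rᵐᵒᵖ] N.carrier
  colinear : ∀ m, N.coact (toLin m) = map toLin LinearMap.id (M.coact m)

/-- The category of right `C`-comodules. -/
instance : Category (RightComodule R C) where
  Hom := RightComodule.Hom
  id M := ⟨LinearMap.id, fun m => by rw [map_id]; rfl⟩
  comp f g := ⟨g.toLin.comp f.toLin, fun m => by
    rw [LinearMap.comp_apply, g.colinear, f.colinear, map_map]; rfl⟩

end Comodule

/-- A functor `F` is naturally full if the maps `Hom(X, Y) → Hom(F X, F Y)` have a right inverse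
that is natural in `X` and `Y`. -/
def NaturallyFull {𝒜 : Type*} [Category 𝒜] {ℬ : Type*} [Category ℬ] (F : 𝒜 ⥤ ℬ) : Prop :=
  ∃ p : ∀ X Y : 𝒜, (F.obj X ⟶ F.obj Y) → (X ⟶ Y),
    (∀ {X Y Z T : 𝒜} (f : X ⟶ Y) (g : F.obj Y ⟶ F.obj Z) (h : Z ⟶ T),
      p X T (F.map f ≫ g ≫ F.map h) = f ≫ p Y Z g ≫ h) ∧
    ∀ (X Y : 𝒜) (g : F.obj X ⟶ F.obj Y), F.map (p X Y g) = g

/-- Let `f, g : X → Y` be homomorphisms of right `R`-modules with equalizer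
`i : E → X`. The left `R`-module `M` preserves this equalizer if
`i ⊗ M : E ⊗_R M → X ⊗_R M` is the equalizer of `f ⊗ M` and `g ⊗ M`. -/
def PreservesEqualizer {R : Type u} [Ring R] (M : Type u) [AddCommGroup M] [Module R M]
    {X Y : Type u} [AddCommGroup X] [Module Rᵐᵒᵖ X] [AddCommGroup Y] [Module Rᵐᵒᵖ Y]
    (f g : X →ₗ[Rᵐᵒᵖ] Y) : Prop :=
  Function.Injective (map (LinearMap.eqLocus f g).subtype (LinearMap.id : M →ₗ[R] M)) ∧
  ∀ x : BTensor R X M, map f LinearMap.id x = map g LinearMap.id x ↔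
    ∃ y, map (LinearMap.eqLocus f g).subtype (LinearMap.id : M →ₗ[R] M) y = x

section CoringHom

variable (R S C D : Type u) [Ring R] [Ring S]
  [AddCommGroup C] [Module R C] [Module Rᵐᵒᵖ C] [SMulCommClass R Rᵐᵒᵖ C] [Coring R C]
  [AddCommGroup D] [Module S D] [Module Sᵐᵒᵖ D] [SMulCommClass S Sᵐᵒᵖ D] [Coring S D]

variable {R S C D} in
/-- The map `C ⊗_R C → D ⊗_S D`, `c ⊗ c' ↦ Φ c ⊗ Φ c'`, where `Φ` is an `R`-bimodule map
and `D` is an `R`-bimodule via `φ`. -/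
def tensorSq (φ : R →+* S) (Φ : C →+ D) (hl : ∀ (r : R) (c : C), Φ (r • c) = φ r • Φ c)
    (hr : ∀ (r : R) (c : C), Φ (op r • c) = op (φ r) • Φ c) : BTensor R C C →+ BTensor S D D :=
  lift (((BTensor.mk S).comp Φ).compl₂ Φ) (fun r c c' => by
    change tmul S (Φ (op r • c)) (Φ c') = tmul S (Φ c) (Φ (r • c'))
    rw [hl, hr, smul_tmul])

/-- A coring homomorphism `(Φ, φ)` from the `R`-coring `C` to the `S`-coring `D`. -/
structure CoringHom where
  base : R →+* S
  toHom : C →+ D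
  map_smul : ∀ (r : R) (c : C), toHom (r • c) = base r • toHom c
  map_op_smul : ∀ (r : R) (c : C), toHom (op r • c) = op (base r) • toHom c
  map_comul : ∀ c, tensorSq base toHom map_smul map_op_smul (comul (R := R) c) =
    comul (R := S) (toHom c)
  map_counit : ∀ c, base (counit (R := R) c) = counit (R := S) (toHom c)

end CoringHom

/-- The additive group of `S`, regarded as a bimodule over `S` and, through `φ`, over `R`. -/
def Res {R S : Type u} [Ring R] [Ring S] (_φ : R →+* S) : Type u := S

namespace Res

variable {R S : Type u} [Ring R] [Ring S] (φ : R →+* S)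

instance : AddCommGroup (Res φ) := inferInstanceAs (AddCommGroup S)
instance : Module S (Res φ) := inferInstanceAs (Module S S)
instance : Module Sᵐᵒᵖ (Res φ) := inferInstanceAs (Module Sᵐᵒᵖ S)
instance : SMulCommClass S Sᵐᵒᵖ (Res φ) := inferInstanceAs (SMulCommClass S Sᵐᵒᵖ S)
instance instRLeft : Module R (Res φ) := Module.compHom S φ
instance instRRight : Module Rᵐᵒᵖ (Res φ) := Module.compHom S φ.op

/-- An element of `S` regarded as an element of the bimodule. -/
def of : S →+ Res φ := AddMonoidHom.id S

/-- The element of `S` underlying an element of the bimodule. -/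
def val : Res φ →+ S := AddMonoidHom.id S

theorem smul_def (s : S) (x : Res φ) : s • x = of φ (s * val φ x) := rfl
theorem op_smul_def (s : S) (x : Res φ) : op s • x = of φ (val φ x * s) := rfl
theorem base_smul_def (r : R) (x : Res φ) : r • x = of φ (φ r * val φ x) := rfl
theorem base_op_smul_def (r : R) (x : Res φ) : op r • x = of φ (val φ x * φ r) := rfl
@[simp] theorem val_of (s : S) : val φ (of φ s) = s := rfl
@[simp] theorem of_val (x : Res φ) : of φ (val φ x) = x := rfl

instance : SMulCommClass S Rᵐᵒᵖ (Res φ) where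
  smul_comm s r x := (mul_assoc s (val φ x) (φ r.unop)).symm

instance : SMulCommClass R Sᵐᵒᵖ (Res φ) where
  smul_comm r s x := (mul_assoc (φ r) (val φ x) s.unop).symm

end Res

section Coactions

variable {R S T C D : Type u} [Ring R] [Ring S] [Ring T]
  [AddCommGroup C] [Module R C] [Module Rᵐᵒᵖ C] [SMulCommClass R Rᵐᵒᵖ C]

/-- For a right coaction `ρ` on the `(S, R)`-bimodule `P`, the right coaction `N ⊗_S ρ` on
`N ⊗_S P`, that is `n ⊗ p ↦ (n ⊗ p₀) ⊗ p₁`. -/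
def lTensorCoact (N : Type u) {P : Type u} [AddCommGroup N] [Module Sᵐᵒᵖ N] [AddCommGroup P]
    [Module S P] [Module Rᵐᵒᵖ P] [SMulCommClass S Rᵐᵒᵖ P] (ρ : BimodHom S R P (BTensor R P C)) :
    BTensor S N P →ₗ[Rᵐᵒᵖ] BTensor R (BTensor S N P) C where
  toFun x := assoc.symm (map LinearMap.id ρ.left x)
  map_add' x y := by rw [map_add, map_add]
  map_smul' r x := by
    rw [map_op_smul' _ _ r (ρ.map_op_smul r), assoc_symm_op_smul]; rfl

section lTensor

variable {N N' P : Type u} [AddCommGroup N] [Module Sᵐᵒᵖ N] [AddCommGroup N'] [Module Sᵐᵒᵖ N']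
  [AddCommGroup P] [Module S P] [Module Rᵐᵒᵖ P] [SMulCommClass S Rᵐᵒᵖ P]
  (ρ : BimodHom S R P (BTensor R P C))

theorem lTensorCoact_tmul (n : N) (p : P) :
    lTensorCoact N ρ (tmul S n p) = assoc.symm (tmul S n (ρ p)) := rfl

theorem lTensorCoact_map (f : N →ₗ[Sᵐᵒᵖ] N') (F : BTensor S N P →ₗ[Rᵐᵒᵖ] BTensor S N' P)
    (hF : ∀ x, F x = map f LinearMap.id x) (x : BTensor S N P) :
    map F LinearMap.id (lTensorCoact N ρ x) = lTensorCoact N' ρ (F x) := by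
  induction x using induction_on with
  | zero => simp only [map_zero]
  | add x y hx hy => simp only [map_add, hx, hy]
  | tmul n p =>
    rw [hF, map_tmul, lTensorCoact_tmul, lTensorCoact_tmul]
    generalize ρ p = y
    induction y using induction_on with
    | zero => simp only [tmul_zero, map_zero]
    | add x y hx hy => simp only [tmul_add, map_add, hx, hy]
    | tmul p c =>
      change tmul R (F (tmul S n p)) c = _
      rw [hF]; rfl

variable [Coring R C]

theorem lTensorCoact_coassoc
    (h : ∀ p, assoc (map ρ.right LinearMap.id (ρ p)) =
      map LinearMap.id (comul (R := R) (C := C)).left (ρ p)) (x : BTensor S N P) :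
    assoc (map (lTensorCoact N ρ) LinearMap.id (lTensorCoact N ρ x)) =
      map LinearMap.id (comul (R := R) (C := C)).left (lTensorCoact N ρ x) := by
  induction x using induction_on with
  | zero => simp only [map_zero]
  | add x y hx hy => simp only [map_add, hx, hy]
  | tmul n p =>
    have h1 : ∀ y : BTensor R P C,
        assoc (map (lTensorCoact N ρ) LinearMap.id (assoc.symm (tmul S n y))) =
          assoc.symm (tmul S n (assoc (map ρ.right LinearMap.id y))) := by
      intro y
      induction y using induction_on with
      | zero => simp only [tmul_zero, map_zero]
      | add x y hx hy => simp only [tmul_add, map_add, hx, hy]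
      | tmul p c =>
        change assoc (tmul R (assoc.symm (tmul S n (ρ p))) c) =
          assoc.symm (tmul S n (assoc (tmul R (ρ p) c)))
        generalize ρ p = y
        induction y using induction_on with
        | zero => simp only [tmul_zero, zero_tmul, map_zero]
        | add x y hx hy => simp only [tmul_add, add_tmul, map_add, hx, hy]
        | tmul p c => rfl
    have h2 : ∀ y : BTensor R P C,
        map LinearMap.id (comul (R := R) (C := C)).left (assoc.symm (tmul S n y)) =
          assoc.symm (tmul S n (map LinearMap.id (comul (R := R) (C := C)).left y)) := by
      intro y
      induction y using induction_on with
      | zero => simp only [tmul_zero, map_zero]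
      | add x y hx hy => simp only [tmul_add, map_add, hx, hy]
      | tmul p c => rfl
    rw [lTensorCoact_tmul, h1, h2, h]

theorem lTensorCoact_counit
    (h : ∀ p, rid R P (map LinearMap.id (counit (R := R) (C := C)).left (ρ p)) = p)
    (x : BTensor S N P) :
    rid R _ (map LinearMap.id (counit (R := R) (C := C)).left (lTensorCoact N ρ x)) = x := by
  induction x using induction_on with
  | zero => simp only [map_zero]
  | add x y hx hy => simp only [map_add, hx, hy]
  | tmul n p =>
    have h1 : ∀ y : BTensor R P C,
        rid R _ (map LinearMap.id (counit (R := R) (C := C)).left (assoc.symm (tmul S n y))) =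
          tmul S n (rid R P (map LinearMap.id (counit (R := R) (C := C)).left y)) := by
      intro y
      induction y using induction_on with
      | zero => simp only [tmul_zero, map_zero]
      | add x y hx hy => simp only [tmul_add, map_add, hx, hy]
      | tmul p c => rfl
    rw [lTensorCoact_tmul, h1, h]

end lTensor

variable [Coring R C]
  [AddCommGroup D] [Module S D] [Module Sᵐᵒᵖ D] [SMulCommClass S Sᵐᵒᵖ D] [Coring S D]
  (Φ : CoringHom R S C D)

/-- The `(S, R)`-bimodule `S ⊗_R C`. -/
abbrev SC : Type u := BTensor R (Res Φ.base) C

/-- The right `C`-coaction `S ⊗_R Δ_C` on `S ⊗_R C`. -/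
def rhoSC : BimodHom S R (SC Φ) (BTensor R (SC Φ) C) where
  toFun := lTensorCoact (Res Φ.base) comul
  map_zero' := map_zero _
  map_add' := map_add _
  map_smul' s x := by
    change assoc.symm (map _ _ (s • x)) = _
    rw [map_smul' _ _ s (fun _ => rfl), assoc_symm_smul]; rfl
  map_op_smul' s x := LinearMap.map_smul _ s x

theorem rhoSC_tmul (s : Res Φ.base) (c : C) :
    rhoSC Φ (tmul R s c) = assoc.symm (tmul R s (comul c)) := rfl

/-- The map `C ⊗_R C → D ⊗_S (S ⊗_R C)`, `c ⊗ c' ↦ Φ c ⊗ (1 ⊗ c')`. -/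
def muSC : BTensor R C C →+ BTensor S D (SC Φ) :=
  lift (((BTensor.mk S).comp Φ.toHom).compl₂ (BTensor.mk R (Res.of Φ.base 1))) (fun r c c' => by
    change tmul S (Φ.toHom (op r • c)) (tmul R (Res.of Φ.base 1) c') =
      tmul S (Φ.toHom c) (tmul R (Res.of Φ.base 1) (r • c'))
    rw [Φ.map_op_smul, smul_tmul, left_smul_tmul, ← smul_tmul r, Res.smul_def,
      Res.base_op_smul_def, Res.val_of, mul_one, one_mul])

theorem muSC_tmul (c c' : C) :
    muSC Φ (tmul R c c') = tmul S (Φ.toHom c) (tmul R (Res.of Φ.base 1) c') := rfl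

theorem muSC_smul (r : R) (x : BTensor R C C) : muSC Φ (r • x) = Φ.base r • muSC Φ x := by
  induction x using induction_on with
  | zero => simp only [smul_zero, map_zero]
  | add x y hx hy => simp only [smul_add, map_add, hx, hy]
  | tmul c c' => rw [left_smul_tmul, muSC_tmul, muSC_tmul, Φ.map_smul, left_smul_tmul]

theorem muSC_op_smul (r : Rᵐᵒᵖ) (x : BTensor R C C) : muSC Φ (r • x) = r • muSC Φ x := by
  induction x using induction_on with
  | zero => simp only [smul_zero, map_zero]
  | add x y hx hy => simp only [smul_add, map_add, hx, hy]
  | tmul c c' => rfl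

/-- `muSC` as a map of right modules. -/
def muSCRight : BTensor R C C →ₗ[Rᵐᵒᵖ] BTensor S D (SC Φ) where
  toFun := muSC Φ
  map_add' := map_add _
  map_smul' := muSC_op_smul Φ

/-- The left `D`-coaction `s ⊗ c ↦ s Φ(c₁) ⊗ (1 ⊗ c₂)` on `S ⊗_R C`. -/
def lambdaSC : BimodHom S R (SC Φ) (BTensor S D (SC Φ)) where
  toAddMonoidHom := lift (AddMonoidHom.mk' (fun s => AddMonoidHom.mk'
      (fun c => Res.val Φ.base s • muSC Φ (comul c))
      (fun c c' => by rw [map_add, map_add, smul_add]))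
      (fun s s' => by
        ext c
        change Res.val Φ.base (s + s') • muSC Φ (comul c) = _
        rw [map_add, add_smul]; rfl))
    (fun r s c => by
      change Res.val Φ.base (op r • s) • muSC Φ (comul c) =
        Res.val Φ.base s • muSC Φ (comul (r • c))
      rw [BimodHom.map_smul, muSC_smul, Res.base_op_smul_def, Res.val_of, mul_smul])
  map_smul' t x := by
    induction x using induction_on with
    | zero => simp only [smul_zero, map_zero, AddMonoidHom.toFun_eq_coe]
    | add x y hx hy =>
      simp only [AddMonoidHom.toFun_eq_coe] at hx hy
      simp only [smul_add, map_add, hx, hy, AddMonoidHom.toFun_eq_coe]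
    | tmul s c =>
      change (t * Res.val Φ.base s) • muSC Φ (comul c) = t • Res.val Φ.base s • muSC Φ (comul c)
      rw [mul_smul]
  map_op_smul' t x := by
    induction x using induction_on with
    | zero => simp only [smul_zero, map_zero, AddMonoidHom.toFun_eq_coe]
    | add x y hx hy =>
      simp only [AddMonoidHom.toFun_eq_coe] at hx hy
      simp only [smul_add, map_add, hx, hy, AddMonoidHom.toFun_eq_coe]
    | tmul s c =>
      change Res.val Φ.base s • muSC Φ (comul (t • c)) =
        t • Res.val Φ.base s • muSC Φ (comul c)
      rw [BimodHom.map_op_smul, muSC_op_smul, smul_comm]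

theorem lambdaSC_tmul (s : Res Φ.base) (c : C) :
    lambdaSC Φ (tmul R s c) = Res.val Φ.base s • muSC Φ (comul c) := rfl

/-- The two coactions on `S ⊗_R C` are compatible. -/
theorem lambdaSC_rhoSC (x : SC Φ) :
    map (lambdaSC Φ).right LinearMap.id (rhoSC Φ x) =
      assoc.symm (map LinearMap.id (rhoSC Φ).left (lambdaSC Φ x)) := by
  induction x using induction_on with
  | zero => simp only [map_zero]
  | add x y hx hy => simp only [map_add, hx, hy]
  | tmul s c =>
    have h1 : ∀ y : BTensor R C C,
        map (lambdaSC Φ).right LinearMap.id (assoc.symm (tmul R s y)) =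
          Res.val Φ.base s • map (muSCRight Φ) LinearMap.id (map comul.right LinearMap.id y) := by
      intro y
      induction y using induction_on with
      | zero => simp only [tmul_zero, map_zero, smul_zero]
      | add x y hx hy => simp only [tmul_add, map_add, hx, hy, smul_add]
      | tmul p c => rfl
    have h2 : ∀ y : BTensor R C C,
        assoc.symm (map LinearMap.id (rhoSC Φ).left (muSC Φ y)) =
          map (muSCRight Φ) LinearMap.id (assoc.symm (map LinearMap.id comul.left y)) := by
      intro y
      induction y using induction_on with
      | zero => simp only [map_zero]
      | add x y hx hy => simp only [map_add, hx, hy]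
      | tmul p c =>
        change assoc.symm (tmul S (Φ.toHom p) (assoc.symm (tmul R (Res.of Φ.base 1) (comul c)))) =
          map (muSCRight Φ) LinearMap.id (assoc.symm (tmul R p (comul c)))
        generalize (comul c : BTensor R C C) = z
        induction z using induction_on with
        | zero => simp only [tmul_zero, map_zero]
        | add x y hx hy => simp only [tmul_add, map_add, hx, hy]
        | tmul p c => rfl
    rw [rhoSC_tmul, h1, lambdaSC_tmul, map_smul' _ _ _ (fun _ => rfl), assoc_symm_smul, h2,
      ← Coring.coassoc, AddEquiv.symm_apply_apply]

/-- The map `C ⊗_R (C ⊗_R C) → D ⊗_S (D ⊗_S (S ⊗_R C))` given by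
`c ⊗ (c' ⊗ c'') ↦ Φ c ⊗ (Φ c' ⊗ (1 ⊗ c''))`. -/
def nuAux : BTensor R C (BTensor R C C) →+ BTensor S D (BTensor S D (SC Φ)) :=
  lift (((BTensor.mk S).comp Φ.toHom).compl₂ (muSC Φ)) (fun r c x => by
    change tmul S (Φ.toHom (op r • c)) (muSC Φ x) = tmul S (Φ.toHom c) (muSC Φ (r • x))
    rw [Φ.map_op_smul, smul_tmul, muSC_smul])

theorem lambdaSC_coassoc (x : SC Φ) :
    assoc (map (comul (R := S) (C := D)).right LinearMap.id (lambdaSC Φ x)) =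
      map LinearMap.id (lambdaSC Φ).left (lambdaSC Φ x) := by
  induction x using induction_on with
  | zero => simp only [map_zero]
  | add x y hx hy => simp only [map_add, hx, hy]
  | tmul s c =>
    rw [lambdaSC_tmul, map_smul' _ _ _ (comul.map_smul _), assoc_smul,
      map_smul' _ _ _ (fun _ => rfl)]
    congr 1
    have h1 : ∀ y : BTensor R C C,
        assoc (map (comul (R := S) (C := D)).right LinearMap.id (muSC Φ y)) =
          nuAux Φ (assoc (map comul.right LinearMap.id y)) := by
      intro y
      induction y using induction_on with
      | zero => simp only [map_zero]
      | add x y hx hy => simp only [map_add, hx, hy]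
      | tmul p c =>
        change assoc (tmul S (comul (Φ.toHom p)) (tmul R (Res.of Φ.base 1) c)) =
          nuAux Φ (assoc (tmul R (comul p) c))
        rw [← Φ.map_comul]
        generalize (comul p : BTensor R C C) = z
        induction z using induction_on with
        | zero => simp only [zero_tmul, map_zero]
        | add x y hx hy => simp only [add_tmul, map_add, hx, hy]
        | tmul p c => rfl
    have h2 : ∀ y : BTensor R C C,
        map LinearMap.id (lambdaSC Φ).left (muSC Φ y) =
          nuAux Φ (map LinearMap.id comul.left y) := by
      intro y
      induction y using induction_on with
      | zero => simp only [map_zero]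
      | add x y hx hy => simp only [map_add, hx, hy]
      | tmul p c =>
        change tmul S (Φ.toHom p) ((1 : S) • muSC Φ (comul c)) =
          tmul S (Φ.toHom p) (muSC Φ (comul c))
        rw [one_smul]
    rw [h1, h2, Coring.coassoc]

theorem lambdaSC_counit (x : SC Φ) :
    lid S (SC Φ) (map (counit (R := S) (C := D)).right LinearMap.id (lambdaSC Φ x)) = x := by
  induction x using induction_on with
  | zero => simp only [map_zero]
  | add x y hx hy => simp only [map_add, hx, hy]
  | tmul s c =>
    have h1 : ∀ y : BTensor R C C,
        lid S (SC Φ) (map (counit (R := S) (C := D)).right LinearMap.id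
          (Res.val Φ.base s • muSC Φ y)) =
          tmul R s (lid R C (map counit.right LinearMap.id y)) := by
      intro y
      induction y using induction_on with
      | zero => simp only [map_zero, smul_zero, tmul_zero]
      | add x y hx hy => simp only [map_add, smul_add, tmul_add, hx, hy]
      | tmul p c =>
        change tmul R (counit (R := S) (Res.val Φ.base s • Φ.toHom p) • Res.of Φ.base 1) c =
          tmul R s (counit (R := R) p • c)
        rw [← smul_tmul, BimodHom.map_smul, ← Φ.map_counit, Res.smul_def, Res.val_of, mul_one,
          Res.base_op_smul_def]
        rfl
    rw [lambdaSC_tmul, h1, Coring.counit_comul]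


/-! ### The coinduction functor -/

/-- The map `ρ_N ⊗_S (S ⊗_R C)`. -/
def cotensorLeft (N : RightComodule S D) :
    BTensor S N.carrier (SC Φ) →ₗ[Rᵐᵒᵖ] BTensor S (BTensor S N.carrier D) (SC Φ) where
  toFun := map N.coact LinearMap.id
  map_add' := map_add _
  map_smul' r x := map_op_smul' _ _ r (fun _ => rfl) x

/-- The map `N ⊗_S λ`, where `λ` is the left `D`-coaction on `S ⊗_R C`. -/
def cotensorRight (N : RightComodule S D) :
    BTensor S N.carrier (SC Φ) →ₗ[Rᵐᵒᵖ] BTensor S (BTensor S N.carrier D) (SC Φ) where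
  toFun x := assoc.symm (map LinearMap.id (lambdaSC Φ).left x)
  map_add' x y := by rw [map_add, map_add]
  map_smul' r x := by
    rw [map_op_smul' _ _ r ((lambdaSC Φ).map_op_smul r), assoc_symm_op_smul]; rfl

/-- The cotensor product `N □_D (S ⊗_R C)`, the equalizer of the two maps above. -/
abbrev cotensor (N : RightComodule S D) : Submodule Rᵐᵒᵖ (BTensor S N.carrier (SC Φ)) :=
  LinearMap.eqLocus (cotensorLeft Φ N) (cotensorRight Φ N)

/-- The left `R`-module `M` preserves the equalizers defining `N □_D (S ⊗_R C)`, for all right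
`D`-comodules `N`. -/
def PreservesCotensor (M : Type u) [AddCommGroup M] [Module R M] : Prop :=
  ∀ N : RightComodule S D, PreservesEqualizer (R := R) M (cotensorLeft Φ N) (cotensorRight Φ N)

section retract

variable {X Y : Type u} [AddCommGroup X] [Module Rᵐᵒᵖ X] [AddCommGroup Y] [Module Rᵐᵒᵖ Y]

/-- A retract of a module preserving an equalizer preserves it. -/
theorem PreservesEqualizer.retract {M M' : Type u} [AddCommGroup M] [Module R M]
    [AddCommGroup M'] [Module R M'] {f g : X →ₗ[Rᵐᵒᵖ] Y} (h : PreservesEqualizer M f g)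
    (a : M' →ₗ[R] M) (b : M →ₗ[R] M') (hba : b.comp a = LinearMap.id) :
    PreservesEqualizer M' f g := by
  have key : ∀ (Z : Type u) [AddCommGroup Z] [Module Rᵐᵒᵖ Z] (z : BTensor R Z M'),
      map (R := R) (LinearMap.id : Z →ₗ[Rᵐᵒᵖ] Z) b (map LinearMap.id a z) = z := by
    intro Z _ _ z
    rw [BTensor.map_map, hba]
    exact BTensor.map_id z
  have swap : ∀ (Z W : Type u) [AddCommGroup Z] [Module Rᵐᵒᵖ Z] [AddCommGroup W] [Module Rᵐᵒᵖ W]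
      (e : Z →ₗ[Rᵐᵒᵖ] W) (P Q : Type u) [AddCommGroup P] [Module R P] [AddCommGroup Q]
      [Module R Q] (c : P →ₗ[R] Q) (z : BTensor R Z P),
      map e LinearMap.id (map LinearMap.id c z) = map LinearMap.id c (map e LinearMap.id z) := by
    intro Z W _ _ _ _ e P Q _ _ _ _ c z
    rw [map_map, map_map]; rfl
  refine ⟨fun y y' hy => ?_, fun x => ⟨fun hx => ?_, ?_⟩⟩
  · rw [← key _ y, ← key _ y']
    congr 1
    apply h.1
    rw [swap, swap, hy]
  · have hx' : map f (LinearMap.id : M →ₗ[R] M) (map LinearMap.id a x) =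
        map g LinearMap.id (map LinearMap.id a x) := by rw [swap, swap, hx]
    obtain ⟨y, hy⟩ := (h.2 _).1 hx'
    refine ⟨map LinearMap.id b y, ?_⟩
    rw [swap, hy, key]
  · rintro ⟨y, rfl⟩
    rw [map_map, map_map]
    congr 2
    ext z
    exact z.2

end retract

/-- If `C ⊗_R C` preserves an equalizer, so does `C`. -/
theorem PreservesCotensor.of_tensor {Φ : CoringHom R S C D} (h : PreservesCotensor Φ (BTensor R C C)) :
    PreservesCotensor Φ C := fun N =>
  (h N).retract comul.left
    { toFun := fun x => lid R C (map counit.right LinearMap.id x)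
      map_add' := fun x y => by rw [map_add, map_add]
      map_smul' := fun r x => by
        rw [map_smul' _ _ r (counit.map_smul r)]
        generalize (map counit.right LinearMap.id x : BTensor R R C) = y
        induction y using induction_on with
        | zero => simp only [smul_zero, map_zero]
        | add x y hx hy => simp only [smul_add, map_add, hx, hy]
        | tmul s c => exact mul_smul r s c }
    (by ext c; exact Coring.counit_comul c)

/-- The right `C`-coaction on `N ⊗_S (S ⊗_R C)`. -/
abbrev ambientCoact (N : RightComodule S D) :
    BTensor S N.carrier (SC Φ) →ₗ[Rᵐᵒᵖ] BTensor R (BTensor S N.carrier (SC Φ)) C :=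
  lTensorCoact N.carrier (rhoSC Φ)

theorem cotensorLeft_colinear (N : RightComodule S D) (x : BTensor S N.carrier (SC Φ)) :
    map (cotensorLeft Φ N) LinearMap.id (ambientCoact Φ N x) =
      lTensorCoact (BTensor S N.carrier D) (rhoSC Φ) (cotensorLeft Φ N x) :=
  lTensorCoact_map (rhoSC Φ) N.coact (cotensorLeft Φ N) (fun _ => rfl) x

theorem cotensorRight_colinear (N : RightComodule S D) (x : BTensor S N.carrier (SC Φ)) :
    map (cotensorRight Φ N) LinearMap.id (ambientCoact Φ N x) =
      lTensorCoact (BTensor S N.carrier D) (rhoSC Φ) (cotensorRight Φ N x) := by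
  induction x using induction_on with
  | zero => simp only [map_zero]
  | add x y hx hy => simp only [map_add, hx, hy]
  | tmul n l =>
    let t : BTensor S D (SC Φ) →ₗ[Rᵐᵒᵖ] BTensor S (BTensor S N.carrier D) (SC Φ) :=
      { toFun := fun z => assoc.symm (tmul S n z)
        map_add' := fun z w => by rw [tmul_add, map_add]
        map_smul' := fun r z => by rw [← right_smul_tmul, assoc_symm_op_smul]; rfl }
    have h1 : ∀ y : BTensor R (SC Φ) C,
        map (cotensorRight Φ N) LinearMap.id (assoc.symm (tmul S n y)) =
          map t LinearMap.id (map (lambdaSC Φ).right LinearMap.id y) := by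
      intro y
      induction y using induction_on with
      | zero => simp only [tmul_zero, map_zero]
      | add x y hx hy => simp only [tmul_add, map_add, hx, hy]
      | tmul p c => rfl
    have h2 : ∀ z : BTensor S D (SC Φ),
        lTensorCoact (BTensor S N.carrier D) (rhoSC Φ) (t z) =
          map t LinearMap.id (assoc.symm (map LinearMap.id (rhoSC Φ).left z)) := by
      intro z
      induction z using induction_on with
      | zero => simp only [map_zero]
      | add x y hx hy => simp only [map_add, hx, hy]
      | tmul d l =>
        change assoc.symm (tmul S (tmul S n d) (rhoSC Φ l)) =
          map t LinearMap.id (assoc.symm (tmul S d (rhoSC Φ l)))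
        generalize rhoSC Φ l = y
        induction y using induction_on with
        | zero => simp only [tmul_zero, map_zero]
        | add x y hx hy => simp only [tmul_add, map_add, hx, hy]
        | tmul p c => rfl
    rw [lTensorCoact_tmul, h1, lambdaSC_rhoSC, ← h2]
    rfl

theorem exists_cotensorCoact (hC : PreservesCotensor Φ C) (N : RightComodule S D)
    (k : cotensor Φ N) : ∃ y : BTensor R (cotensor Φ N) C,
      map (cotensor Φ N).subtype LinearMap.id y = ambientCoact Φ N k := by
  apply ((hC N).2 _).1
  rw [cotensorLeft_colinear, cotensorRight_colinear]
  congr 1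
  exact k.2

/-- The right `C`-coaction on `N □_D (S ⊗_R C)`: the unique map whose composite with the inclusion
into `(N ⊗_S (S ⊗_R C)) ⊗_R C` is the restriction of the coaction of `N ⊗_S (S ⊗_R C)`. -/
noncomputable def cotensorCoact (hC : PreservesCotensor Φ C) (N : RightComodule S D) :
    cotensor Φ N →ₗ[Rᵐᵒᵖ] BTensor R (cotensor Φ N) C where
  toFun k := (exists_cotensorCoact Φ hC N k).choose
  map_add' k k' := by
    apply (hC N).1
    rw [map_add]
    refine ((exists_cotensorCoact Φ hC N (k + k')).choose_spec).trans ?_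
    refine Eq.trans ?_ (congrArg₂ (· + ·) (exists_cotensorCoact Φ hC N k).choose_spec
      (exists_cotensorCoact Φ hC N k').choose_spec).symm
    exact map_add (ambientCoact Φ N) (k : BTensor S N.carrier (SC Φ)) k'
  map_smul' r k := by
    apply (hC N).1
    rw [map_op_smul' _ _ _ (fun _ => rfl)]
    refine ((exists_cotensorCoact Φ hC N (r • k)).choose_spec).trans ?_
    refine Eq.trans ?_ (congrArg (r • ·) (exists_cotensorCoact Φ hC N k).choose_spec).symm
    exact LinearMap.map_smul (ambientCoact Φ N) r (k : BTensor S N.carrier (SC Φ))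

theorem cotensorCoact_spec (hC : PreservesCotensor Φ C) (N : RightComodule S D)
    (k : cotensor Φ N) :
    map (cotensor Φ N).subtype LinearMap.id (cotensorCoact Φ hC N k) = ambientCoact Φ N k :=
  (exists_cotensorCoact Φ hC N k).choose_spec

theorem rhoSC_coassoc (x : SC Φ) : assoc (map (rhoSC Φ).right LinearMap.id (rhoSC Φ x)) =
    map LinearMap.id (comul (R := R) (C := C)).left (rhoSC Φ x) :=
  lTensorCoact_coassoc (N := Res Φ.base) comul Coring.coassoc x

theorem rhoSC_counit (x : SC Φ) :
    rid R (SC Φ) (map LinearMap.id (counit (R := R) (C := C)).left (rhoSC Φ x)) = x :=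
  lTensorCoact_counit (N := Res Φ.base) comul Coring.comul_counit x

theorem rid_map {M M' : Type u} [AddCommGroup M] [Module Rᵐᵒᵖ M] [AddCommGroup M']
    [Module Rᵐᵒᵖ M'] (f : M →ₗ[Rᵐᵒᵖ] M') (x : BTensor R M R) :
    rid R M' (map f LinearMap.id x) = f (rid R M x) := by
  induction x using induction_on with
  | zero => simp only [map_zero]
  | add x y hx hy => simp only [map_add, hx, hy]
  | tmul m r => exact (f.map_smul (op r) m).symm

theorem assoc_map {M M' P Q : Type u} [AddCommGroup M] [Module Rᵐᵒᵖ M] [AddCommGroup M']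
    [Module Rᵐᵒᵖ M'] [AddCommGroup P] [Module R P] [Module Rᵐᵒᵖ P] [SMulCommClass R Rᵐᵒᵖ P]
    [AddCommGroup Q] [Module R Q] (f : M →ₗ[Rᵐᵒᵖ] M')
    (F : BTensor R M P →ₗ[Rᵐᵒᵖ] BTensor R M' P) (hF : ∀ x, F x = map f LinearMap.id x)
    (x : BTensor R (BTensor R M P) Q) :
    assoc (map F LinearMap.id x) = map f LinearMap.id (assoc x) := by
  induction x using induction_on with
  | zero => simp only [map_zero]
  | add x y hx hy => simp only [map_add, hx, hy]
  | tmul m q =>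
    rw [map_tmul, hF]
    induction m using induction_on with
    | zero => simp only [map_zero, zero_tmul]
    | add x y hx hy => simp only [map_add, add_tmul, hx, hy]
    | tmul m p => rfl

/-- `N □_D (S ⊗_R C)` as a right `C`-comodule. -/
noncomputable def cotensorComodule (hCC : PreservesCotensor Φ (BTensor R C C))
    (N : RightComodule S D) : RightComodule R C where
  carrier := cotensor Φ N
  coact := cotensorCoact Φ hCC.of_tensor N
  coassoc k := by
    apply (hCC N).1
    let i := (cotensor Φ N).subtype
    let F : BTensor R (cotensor Φ N) C →ₗ[Rᵐᵒᵖ] BTensor R (BTensor S N.carrier (SC Φ)) C :=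
      { toFun := map i LinearMap.id
        map_add' := map_add _
        map_smul' := fun r x => map_op_smul' _ _ r (fun _ => rfl) x }
    have h1 := assoc_map i F (fun _ => rfl)
      (map (cotensorCoact Φ hCC.of_tensor N) (LinearMap.id : C →ₗ[R] C)
        (cotensorCoact Φ hCC.of_tensor N k))
    have h2 : F.comp (cotensorCoact Φ hCC.of_tensor N) = (ambientCoact Φ N).comp i := by
      ext k
      exact cotensorCoact_spec Φ hCC.of_tensor N k
    refine h1.symm.trans ?_
    rw [map_map, h2]
    have h3 := lTensorCoact_coassoc (N := N.carrier) (rhoSC Φ) (rhoSC_coassoc Φ) k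
    have h4 := cotensorCoact_spec Φ hCC.of_tensor N k
    rw [← h4, map_map, map_map] at h3
    refine h3.trans ?_
    symm
    exact map_map _ _ _ _ _
  coact_counit k := by
    apply Subtype.ext
    change (cotensor Φ N).subtype (rid R (cotensor Φ N) _) = _
    rw [← rid_map, map_map]
    have h3 := lTensorCoact_counit (N := N.carrier) (rhoSC Φ) (rhoSC_counit Φ) k
    have h4 := cotensorCoact_spec Φ hCC.of_tensor N k
    rw [← h4, map_map] at h3
    exact h3

/-- The map `h ⊗_S (S ⊗_R C)` for a colinear map `h`. -/
def ambientMap {N N' : RightComodule S D} (h : N ⟶ N') :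
    BTensor S N.carrier (SC Φ) →ₗ[Rᵐᵒᵖ] BTensor S N'.carrier (SC Φ) where
  toFun := map h.toLin LinearMap.id
  map_add' := map_add _
  map_smul' r x := map_op_smul' _ _ r (fun _ => rfl) x

theorem ambientMap_mem {N N' : RightComodule S D} (h : N ⟶ N')
    (x : BTensor S N.carrier (SC Φ)) (hx : x ∈ cotensor Φ N) :
    ambientMap Φ h x ∈ cotensor Φ N' := by
  let F : BTensor S N.carrier D →ₗ[Sᵐᵒᵖ] BTensor S N'.carrier D :=
    { toFun := map h.toLin LinearMap.id
      map_add' := map_add _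
      map_smul' := fun r x => map_op_smul' _ _ r (fun _ => rfl) x }
  have h1 : ∀ x, cotensorLeft Φ N' (ambientMap Φ h x) =
      map F LinearMap.id (cotensorLeft Φ N x) := by
    intro x
    change map _ _ (map _ _ x) = map _ _ (map _ _ x)
    rw [map_map, map_map]
    congr 2
    ext n
    exact h.colinear n
  have h2 : ∀ x, cotensorRight Φ N' (ambientMap Φ h x) =
      map F LinearMap.id (cotensorRight Φ N x) := by
    intro x
    induction x using induction_on with
    | zero => simp only [map_zero]
    | add x y hx hy => simp only [map_add, hx, hy]
    | tmul n l =>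
      change assoc.symm (tmul S (h.toLin n) (lambdaSC Φ l)) =
        map F LinearMap.id (assoc.symm (tmul S n (lambdaSC Φ l)))
      generalize lambdaSC Φ l = y
      induction y using induction_on with
      | zero => simp only [tmul_zero, map_zero]
      | add x y hx hy => simp only [tmul_add, map_add, hx, hy]
      | tmul p c => rfl
  change cotensorLeft Φ N' _ = cotensorRight Φ N' _
  rw [h1, h2]
  exact congrArg _ hx

/-- The colinear map `h □_D (S ⊗_R C)`, the restriction of `h ⊗_S (S ⊗_R C)`. -/
noncomputable def coinductionMap (hCC : PreservesCotensor Φ (BTensor R C C))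
    {N N' : RightComodule S D} (h : N ⟶ N') :
    RightComodule.Hom (cotensorComodule Φ hCC N) (cotensorComodule Φ hCC N') where
  toLin := (ambientMap Φ h).restrict (ambientMap_mem Φ h)
  colinear := fun (k : cotensor Φ N) => by
    apply (hCC.of_tensor N').1
    refine (cotensorCoact_spec Φ hCC.of_tensor N' _).trans ?_
    refine Eq.trans ?_ (map_map _ _ _ _ _).symm
    have h1 := lTensorCoact_map (rhoSC Φ) h.toLin (ambientMap Φ h) (fun _ => rfl)
      (k : BTensor S N.carrier (SC Φ))
    refine h1.symm.trans ?_
    have h2 := cotensorCoact_spec Φ hCC.of_tensor N k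
    change map (ambientMap Φ h) LinearMap.id (ambientCoact Φ N k) = _
    rw [← h2]
    exact map_map _ _ _ _ _

/-- The coinduction functor `- □_D (S ⊗_R C)` from right `D`-comodules to right `C`-comodules. -/
noncomputable def coinduction (hCC : PreservesCotensor Φ (BTensor R C C)) :
    RightComodule S D ⥤ RightComodule R C where
  obj N := cotensorComodule Φ hCC N
  map h := coinductionMap Φ hCC h
  map_id N := by
    apply RightComodule.Hom.ext
    apply LinearMap.ext
    intro (k : cotensor Φ N)
    apply Subtype.ext
    exact BTensor.map_id (k : BTensor S N.carrier (SC Φ))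
  map_comp {N N' N''} f g := by
    apply RightComodule.Hom.ext
    apply LinearMap.ext
    intro (k : cotensor Φ N)
    apply Subtype.ext
    exact (BTensor.map_map (R := S) g.toLin LinearMap.id f.toLin LinearMap.id
      (k : BTensor S N.carrier (SC Φ))).symm

/-! ### Bicomodules -/

/-- Bicomodules over the `S`-coring `D`: `S`-bimodules with a left and a right comodule structure
whose coactions are `S`-bimodule maps and are compatible. -/
structure Bicomodule (S D : Type u) [Ring S] [AddCommGroup D] [Module S D] [Module Sᵐᵒᵖ D]
    [SMulCommClass S Sᵐᵒᵖ D] [Coring S D] where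
  carrier : Type u
  [addCommGroup : AddCommGroup carrier]
  [moduleLeft : Module S carrier]
  [moduleRight : Module Sᵐᵒᵖ carrier]
  [smulCommClass : SMulCommClass S Sᵐᵒᵖ carrier]
  lcoact : BimodHom S S carrier (BTensor S D carrier)
  rcoact : BimodHom S S carrier (BTensor S carrier D)
  lcoassoc : ∀ x, assoc (map (comul (R := S) (C := D)).right LinearMap.id (lcoact x)) =
    map LinearMap.id lcoact.left (lcoact x)
  lcounit : ∀ x, lid S carrier
    (map (counit (R := S) (C := D)).right LinearMap.id (lcoact x)) = x
  rcoassoc : ∀ x, assoc (map rcoact.right LinearMap.id (rcoact x)) =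
    map LinearMap.id (comul (R := S) (C := D)).left (rcoact x)
  rcounit : ∀ x, rid S carrier
    (map LinearMap.id (counit (R := S) (C := D)).left (rcoact x)) = x
  compat : ∀ x, assoc (map lcoact.right LinearMap.id (rcoact x)) =
    map LinearMap.id rcoact.left (lcoact x)

attribute [instance] Bicomodule.addCommGroup Bicomodule.moduleLeft Bicomodule.moduleRight
  Bicomodule.smulCommClass

/-- Homomorphisms of bicomodules: bimodule maps that are left and right colinear. -/
@[ext] structure Bicomodule.Hom (X Y : Bicomodule S D) where
  toBimodHom : BimodHom S S X.carrier Y.carrier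
  lcolinear : ∀ x, Y.lcoact (toBimodHom x) =
    map LinearMap.id toBimodHom.left (X.lcoact x)
  rcolinear : ∀ x, Y.rcoact (toBimodHom x) =
    map toBimodHom.right LinearMap.id (X.rcoact x)

/-- The category of `D`-bicomodules. -/
instance : Category (Bicomodule S D) where
  Hom := Bicomodule.Hom
  id X := ⟨BimodHom.id, fun x => (BTensor.map_id _).symm, fun x => (BTensor.map_id _).symm⟩
  comp f g := ⟨g.toBimodHom.comp f.toBimodHom,
    fun x => by
      rw [BimodHom.comp_apply, g.lcolinear, f.lcolinear, BTensor.map_map]; rfl,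
    fun x => by
      rw [BimodHom.comp_apply, g.rcolinear, f.rcolinear, BTensor.map_map]; rfl⟩

variable (S D) in
/-- The coring `D` as a bicomodule over itself. -/
def regularBicomodule : Bicomodule S D where
  carrier := D
  lcoact := comul
  rcoact := comul
  lcoassoc := Coring.coassoc
  lcounit := Coring.counit_comul
  rcoassoc := Coring.coassoc
  rcounit := Coring.comul_counit
  compat := Coring.coassoc

/-- The `S`-bimodule `S ⊗_R C ⊗_R S`. -/
abbrev SCS : Type u := BTensor R (SC Φ) (Res Φ.base)

/-- The left `D`-coaction `s ⊗ c ⊗ s' ↦ s Φ(c₁) ⊗ (1 ⊗ c₂ ⊗ s')` on `S ⊗_R C ⊗_R S`. -/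
def lambdaSCS : BimodHom S S (SCS Φ) (BTensor S D (SCS Φ)) where
  toFun x := assoc (map (lambdaSC Φ).right LinearMap.id x)
  map_zero' := by rw [map_zero, map_zero]
  map_add' x y := by rw [map_add, map_add]
  map_smul' s x := by
    rw [map_smul' _ _ s ((lambdaSC Φ).map_smul s), assoc_smul]
  map_op_smul' s x := by
    rw [map_op_smul' _ _ s (fun _ => rfl), assoc_op_smul]

theorem lambdaSCS_tmul (x : SC Φ) (s : Res Φ.base) :
    lambdaSCS Φ (tmul R x s) = assoc (tmul R (lambdaSC Φ x) s) := rfl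

/-- The map `(S ⊗_R C) ⊗_R C → (S ⊗_R C ⊗_R S) ⊗_S D`, `x ⊗ c ↦ (x ⊗ 1) ⊗ Φ c`. -/
def muSCS : BTensor R (SC Φ) C →+ BTensor S (SCS Φ) D :=
  lift (((BTensor.mk S).comp ((BTensor.mk R).flip (Res.of Φ.base 1))).compl₂ Φ.toHom)
    (fun r x c => by
      change tmul S (tmul R (op r • x) (Res.of Φ.base 1)) (Φ.toHom c) =
        tmul S (tmul R x (Res.of Φ.base 1)) (Φ.toHom (r • c))
      rw [Φ.map_smul, ← smul_tmul (Φ.base r), right_smul_tmul, smul_tmul, Res.op_smul_def,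
        Res.base_smul_def, Res.val_of, mul_one, one_mul])

theorem muSCS_tmul (x : SC Φ) (c : C) :
    muSCS Φ (tmul R x c) = tmul S (tmul R x (Res.of Φ.base 1)) (Φ.toHom c) := rfl

theorem muSCS_smul (s : S) (y : BTensor R (SC Φ) C) : muSCS Φ (s • y) = s • muSCS Φ y := by
  induction y using induction_on with
  | zero => simp only [smul_zero, map_zero]
  | add x y hx hy => simp only [smul_add, map_add, hx, hy]
  | tmul x c => rfl

theorem muSCS_op_smul (r : R) (y : BTensor R (SC Φ) C) :
    muSCS Φ (op r • y) = op (Φ.base r) • muSCS Φ y := by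
  induction y using induction_on with
  | zero => simp only [smul_zero, map_zero]
  | add x y hx hy => simp only [smul_add, map_add, hx, hy]
  | tmul x c => rw [right_smul_tmul, muSCS_tmul, muSCS_tmul, Φ.map_op_smul, right_smul_tmul]

/-- `muSCS` as a map of left modules. -/
def muSCSLeft : BTensor R (SC Φ) C →ₗ[S] BTensor S (SCS Φ) D where
  toFun := muSCS Φ
  map_add' := map_add _
  map_smul' := muSCS_smul Φ

/-- The right `D`-coaction `s ⊗ c ⊗ s' ↦ (s ⊗ c₁ ⊗ 1) ⊗ Φ(c₂) s'` on `S ⊗_R C ⊗_R S`. -/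
def rhoSCS : BimodHom S S (SCS Φ) (BTensor S (SCS Φ) D) where
  toAddMonoidHom := lift (AddMonoidHom.mk' (fun x => AddMonoidHom.mk'
      (fun s => op (Res.val Φ.base s) • muSCS Φ (rhoSC Φ x))
      (fun s s' => by rw [map_add, MulOpposite.op_add, add_smul]))
      (fun x x' => by
        ext s
        change op (Res.val Φ.base s) • muSCS Φ (rhoSC Φ (x + x')) = _
        rw [map_add, map_add, smul_add]; rfl))
    (fun r x s => by
      change op (Res.val Φ.base s) • muSCS Φ (rhoSC Φ (op r • x)) =
        op (Res.val Φ.base (r • s)) • muSCS Φ (rhoSC Φ x)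
      rw [BimodHom.map_op_smul, muSCS_op_smul, Res.base_smul_def, Res.val_of, MulOpposite.op_mul,
        mul_smul])
  map_smul' t x := by
    induction x using induction_on with
    | zero => simp only [smul_zero, map_zero, AddMonoidHom.toFun_eq_coe]
    | add x y hx hy =>
      simp only [AddMonoidHom.toFun_eq_coe] at hx hy
      simp only [smul_add, map_add, hx, hy, AddMonoidHom.toFun_eq_coe]
    | tmul x s =>
      change op (Res.val Φ.base s) • muSCS Φ (rhoSC Φ (t • x)) =
        t • op (Res.val Φ.base s) • muSCS Φ (rhoSC Φ x)
      rw [BimodHom.map_smul, muSCS_smul]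
      exact (smul_comm t _ _).symm
  map_op_smul' t x := by
    induction x using induction_on with
    | zero => simp only [smul_zero, map_zero, AddMonoidHom.toFun_eq_coe]
    | add x y hx hy =>
      simp only [AddMonoidHom.toFun_eq_coe] at hx hy
      simp only [smul_add, map_add, hx, hy, AddMonoidHom.toFun_eq_coe]
    | tmul x s =>
      change (t * op (Res.val Φ.base s)) • muSCS Φ (rhoSC Φ x) =
        t • op (Res.val Φ.base s) • muSCS Φ (rhoSC Φ x)
      rw [mul_smul]

theorem rhoSCS_tmul (x : SC Φ) (s : Res Φ.base) :
    rhoSCS Φ (tmul R x s) = op (Res.val Φ.base s) • muSCS Φ (rhoSC Φ x) := rfl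

theorem lambdaSCS_coassoc (x : SCS Φ) :
    assoc (map (comul (R := S) (C := D)).right LinearMap.id (lambdaSCS Φ x)) =
      map LinearMap.id (lambdaSCS Φ).left (lambdaSCS Φ x) := by
  induction x using induction_on with
  | zero => simp only [map_zero]
  | add x y hx hy => simp only [map_add, hx, hy]
  | tmul x s =>
    let t : BTensor S D (BTensor S D (SC Φ)) →+ BTensor S D (BTensor S D (SCS Φ)) :=
      map LinearMap.id
        { toFun := fun z => assoc (tmul R z s)
          map_add' := fun z w => by rw [add_tmul, map_add]
          map_smul' := fun r z => by rw [← left_smul_tmul, assoc_smul]; rfl }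
    have h1 : ∀ z : BTensor S D (SC Φ),
        assoc (map (comul (R := S) (C := D)).right LinearMap.id (assoc (tmul R z s))) =
          t (assoc (map (comul (R := S) (C := D)).right LinearMap.id z)) := by
      intro z
      induction z using induction_on with
      | zero => simp only [zero_tmul, map_zero]
      | add x y hx hy => simp only [add_tmul, map_add, hx, hy]
      | tmul d l =>
        change assoc (tmul S (comul d) (tmul R l s)) = t (assoc (tmul S (comul d) l))
        generalize (comul d : BTensor S D D) = y
        induction y using induction_on with
        | zero => simp only [zero_tmul, map_zero]
        | add x y hx hy => simp only [add_tmul, map_add, hx, hy]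
        | tmul p c => rfl
    have h2 : ∀ z : BTensor S D (SC Φ),
        map LinearMap.id (lambdaSCS Φ).left (assoc (tmul R z s)) =
          t (map LinearMap.id (lambdaSC Φ).left z) := by
      intro z
      induction z using induction_on with
      | zero => simp only [zero_tmul, map_zero]
      | add x y hx hy => simp only [add_tmul, map_add, hx, hy]
      | tmul d l => rfl
    rw [lambdaSCS_tmul, h1, h2, lambdaSC_coassoc]

theorem lambdaSCS_counit (x : SCS Φ) :
    lid S (SCS Φ) (map (counit (R := S) (C := D)).right LinearMap.id (lambdaSCS Φ x)) = x := by
  induction x using induction_on with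
  | zero => simp only [map_zero]
  | add x y hx hy => simp only [map_add, hx, hy]
  | tmul x s =>
    have h1 : ∀ z : BTensor S D (SC Φ),
        lid S (SCS Φ) (map (counit (R := S) (C := D)).right LinearMap.id
          (assoc (tmul R z s))) =
          tmul R (lid S (SC Φ) (map (counit (R := S) (C := D)).right LinearMap.id z)) s := by
      intro z
      induction z using induction_on with
      | zero => simp only [zero_tmul, map_zero]
      | add x y hx hy => simp only [add_tmul, map_add, hx, hy]
      | tmul d l => rfl
    rw [lambdaSCS_tmul, h1, lambdaSC_counit]

theorem rhoSCS_coassoc (x : SCS Φ) :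
    assoc (map (rhoSCS Φ).right LinearMap.id (rhoSCS Φ x)) =
      map LinearMap.id (comul (R := S) (C := D)).left (rhoSCS Φ x) := by
  induction x using induction_on with
  | zero => simp only [map_zero]
  | add x y hx hy => simp only [map_add, hx, hy]
  | tmul x s =>
    let sq : BTensor R C C →+ BTensor S D D :=
      tensorSq Φ.base Φ.toHom Φ.map_smul Φ.map_op_smul
    have hsq : ∀ (r : R) (w : BTensor R C C), sq (r • w) = Φ.base r • sq w := by
      intro r w
      induction w using induction_on with
      | zero => simp only [smul_zero, map_zero]
      | add x y hx hy => simp only [smul_add, map_add, hx, hy]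
      | tmul c c' =>
        change tmul S (Φ.toHom (r • c)) (Φ.toHom c') = _
        rw [Φ.map_smul]; rfl
    let b : BTensor R (SC Φ) (BTensor R C C) →+ BTensor S (SCS Φ) (BTensor S D D) :=
      lift (((BTensor.mk S).comp ((BTensor.mk R).flip (Res.of Φ.base 1))).compl₂ sq)
        (fun r x w => by
          change tmul S (tmul R (op r • x) (Res.of Φ.base 1)) (sq w) =
            tmul S (tmul R x (Res.of Φ.base 1)) (sq (r • w))
          rw [hsq, ← smul_tmul (Φ.base r), right_smul_tmul, smul_tmul, Res.op_smul_def,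
            Res.base_smul_def, Res.val_of, mul_one, one_mul])
    have h1 : ∀ y : BTensor R (SC Φ) C,
        assoc (map (rhoSCS Φ).right LinearMap.id (muSCS Φ y)) =
          b (assoc (map (rhoSC Φ).right LinearMap.id y)) := by
      intro y
      induction y using induction_on with
      | zero => simp only [map_zero]
      | add x y hx hy => simp only [map_add, hx, hy]
      | tmul p c =>
        change assoc (tmul S (op (1 : S) • muSCS Φ (rhoSC Φ p)) (Φ.toHom c)) =
          b (assoc (tmul R (rhoSC Φ p) c))
        rw [MulOpposite.op_one, one_smul]
        generalize rhoSC Φ p = z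
        induction z using induction_on with
        | zero => simp only [zero_tmul, map_zero]
        | add x y hx hy => simp only [add_tmul, map_add, hx, hy]
        | tmul p c => rfl
    have h2 : ∀ y : BTensor R (SC Φ) C,
        map LinearMap.id (comul (R := S) (C := D)).left (muSCS Φ y) =
          b (map LinearMap.id (comul (R := R) (C := C)).left y) := by
      intro y
      induction y using induction_on with
      | zero => simp only [map_zero]
      | add x y hx hy => simp only [map_add, hx, hy]
      | tmul p c =>
        change tmul S (tmul R p (Res.of Φ.base 1)) (comul (Φ.toHom c)) =
          tmul S (tmul R p (Res.of Φ.base 1)) (sq (comul c))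
        rw [← Φ.map_comul]
    rw [rhoSCS_tmul, map_op_smul' _ _ _ (fun _ => rfl), assoc_op_smul, h1,
      map_op_smul' _ _ _ (BimodHom.map_op_smul _ _), h2, rhoSC_coassoc]

theorem rhoSCS_counit (x : SCS Φ) :
    rid S (SCS Φ) (map LinearMap.id (counit (R := S) (C := D)).left (rhoSCS Φ x)) = x := by
  induction x using induction_on with
  | zero => simp only [map_zero]
  | add x y hx hy => simp only [map_add, hx, hy]
  | tmul x s =>
    have h1 : ∀ y : BTensor R (SC Φ) C,
        rid S (SCS Φ) (map LinearMap.id (counit (R := S) (C := D)).left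
          (op (Res.val Φ.base s) • muSCS Φ y)) =
          tmul R (rid R (SC Φ) (map LinearMap.id (counit (R := R) (C := C)).left y)) s := by
      intro y
      induction y using induction_on with
      | zero => simp only [zero_tmul, smul_zero, map_zero]
      | add x y hx hy => simp only [add_tmul, smul_add, map_add, hx, hy]
      | tmul p c =>
        change tmul R p (op (counit (R := S) (op (Res.val Φ.base s) • Φ.toHom c)) •
          Res.of Φ.base 1) = tmul R (op (counit (R := R) c) • p) s
        rw [smul_tmul, BimodHom.map_op_smul, ← Φ.map_counit, Res.op_smul_def, Res.val_of, one_mul,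
          Res.base_smul_def]
        rfl
    rw [rhoSCS_tmul, h1, rhoSC_counit]

theorem lambdaSCS_rhoSCS (x : SCS Φ) :
    assoc (map (lambdaSCS Φ).right LinearMap.id (rhoSCS Φ x)) =
      map LinearMap.id (rhoSCS Φ).left (lambdaSCS Φ x) := by
  induction x using induction_on with
  | zero => simp only [map_zero]
  | add x y hx hy => simp only [map_add, hx, hy]
  | tmul x s =>
    have h1 : ∀ y : BTensor R (SC Φ) C,
        assoc (map (lambdaSCS Φ).right LinearMap.id (muSCS Φ y)) =
          map LinearMap.id (muSCSLeft Φ)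
            (assoc (map (lambdaSC Φ).right LinearMap.id y)) := by
      intro y
      induction y using induction_on with
      | zero => simp only [map_zero]
      | add x y hx hy => simp only [map_add, hx, hy]
      | tmul p c =>
        change assoc (tmul S (assoc (tmul R (lambdaSC Φ p) (Res.of Φ.base 1))) (Φ.toHom c)) =
          map LinearMap.id (muSCSLeft Φ) (assoc (tmul R (lambdaSC Φ p) c))
        generalize lambdaSC Φ p = z
        induction z using induction_on with
        | zero => simp only [zero_tmul, map_zero]
        | add x y hx hy => simp only [add_tmul, map_add, hx, hy]
        | tmul p c => rfl
    have h2 : ∀ z : BTensor S D (SC Φ),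
        map LinearMap.id (rhoSCS Φ).left (assoc (tmul R z s)) =
          op (Res.val Φ.base s) • map LinearMap.id (muSCSLeft Φ)
            (map LinearMap.id (rhoSC Φ).left z) := by
      intro z
      induction z using induction_on with
      | zero => simp only [zero_tmul, map_zero, smul_zero]
      | add x y hx hy => simp only [add_tmul, map_add, hx, hy, smul_add]
      | tmul d l => rfl
    rw [rhoSCS_tmul, map_op_smul' _ _ _ (fun _ => rfl), assoc_op_smul, h1,
      lambdaSCS_tmul, h2, lambdaSC_rhoSC, AddEquiv.apply_symm_apply]

/-- `S ⊗_R C ⊗_R S` as a `D`-bicomodule. -/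
def bicomoduleSCS : Bicomodule S D where
  carrier := SCS Φ
  lcoact := lambdaSCS Φ
  rcoact := rhoSCS Φ
  lcoassoc := lambdaSCS_coassoc Φ
  lcounit := lambdaSCS_counit Φ
  rcoassoc := rhoSCS_coassoc Φ
  rcounit := rhoSCS_counit Φ
  compat := lambdaSCS_rhoSCS Φ

/-- The map `S ⊗_R C → D`, `s ⊗ c ↦ s Φ(c)`. -/
def phiSC : SC Φ →+ D :=
  lift (AddMonoidHom.mk' (fun s => AddMonoidHom.mk' (fun c => Res.val Φ.base s • Φ.toHom c)
      (fun c c' => by rw [map_add, smul_add]))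
      (fun s s' => by
        ext c
        change Res.val Φ.base (s + s') • Φ.toHom c = _
        rw [map_add, add_smul]; rfl))
    (fun r s c => by
      change Res.val Φ.base (op r • s) • Φ.toHom c = Res.val Φ.base s • Φ.toHom (r • c)
      rw [Φ.map_smul, Res.base_op_smul_def, Res.val_of, mul_smul])

theorem phiSC_smul (s : S) (x : SC Φ) : phiSC Φ (s • x) = s • phiSC Φ x := by
  induction x using induction_on with
  | zero => simp only [smul_zero, map_zero]
  | add x y hx hy => simp only [smul_add, map_add, hx, hy]
  | tmul t c => exact mul_smul s (Res.val Φ.base t) (Φ.toHom c)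

theorem phiSC_op_smul (r : R) (x : SC Φ) : phiSC Φ (op r • x) = op (Φ.base r) • phiSC Φ x := by
  induction x using induction_on with
  | zero => simp only [smul_zero, map_zero]
  | add x y hx hy => simp only [smul_add, map_add, hx, hy]
  | tmul t c =>
    change Res.val Φ.base t • Φ.toHom (op r • c) =
      op (Φ.base r) • Res.val Φ.base t • Φ.toHom c
    rw [Φ.map_op_smul, smul_comm]

/-- The map `S ⊗_R C ⊗_R S → D`, `s ⊗ c ⊗ s' ↦ s Φ(c) s'`, as a bimodule map. -/
def phiHatBimod : BimodHom S S (SCS Φ) D where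
  toAddMonoidHom := lift (AddMonoidHom.mk' (fun x => AddMonoidHom.mk'
      (fun s => op (Res.val Φ.base s) • phiSC Φ x)
      (fun s s' => by rw [map_add, MulOpposite.op_add, add_smul]))
      (fun x x' => by
        ext s
        change op (Res.val Φ.base s) • phiSC Φ (x + x') = _
        rw [map_add, smul_add]; rfl))
    (fun r x s => by
      change op (Res.val Φ.base s) • phiSC Φ (op r • x) =
        op (Res.val Φ.base (r • s)) • phiSC Φ x
      rw [phiSC_op_smul, Res.base_smul_def, Res.val_of, MulOpposite.op_mul, mul_smul])
  map_smul' t x := by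
    induction x using induction_on with
    | zero => simp only [smul_zero, map_zero, AddMonoidHom.toFun_eq_coe]
    | add x y hx hy =>
      simp only [AddMonoidHom.toFun_eq_coe] at hx hy
      simp only [smul_add, map_add, hx, hy, AddMonoidHom.toFun_eq_coe]
    | tmul x s =>
      change op (Res.val Φ.base s) • phiSC Φ (t • x) =
        t • op (Res.val Φ.base s) • phiSC Φ x
      rw [phiSC_smul]
      exact (smul_comm t _ _).symm
  map_op_smul' t x := by
    induction x using induction_on with
    | zero => simp only [smul_zero, map_zero, AddMonoidHom.toFun_eq_coe]
    | add x y hx hy =>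
      simp only [AddMonoidHom.toFun_eq_coe] at hx hy
      simp only [smul_add, map_add, hx, hy, AddMonoidHom.toFun_eq_coe]
    | tmul x s =>
      change (t * op (Res.val Φ.base s)) • phiSC Φ x = t • op (Res.val Φ.base s) • phiSC Φ x
      rw [mul_smul]

theorem phiHatBimod_tmul (s : S) (c : C) (s' : S) :
    phiHatBimod Φ (tmul R (tmul R (Res.of Φ.base s) c) (Res.of Φ.base s')) =
      op s' • s • Φ.toHom c := rfl

theorem phiHat_lcolinear (x : SCS Φ) : comul (R := S) (phiHatBimod Φ x) =
    map LinearMap.id (phiHatBimod Φ).left (lambdaSCS Φ x) := by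
  induction x using induction_on with
  | zero => simp only [map_zero]
  | add x y hx hy => simp only [map_add, hx, hy]
  | tmul x s' =>
    induction x using induction_on with
    | zero => simp only [zero_tmul, map_zero]
    | add x y hx hy => simp only [add_tmul, map_add, hx, hy]
    | tmul s c =>
      have h1 : ∀ y : BTensor R C C,
          map LinearMap.id (phiHatBimod Φ).left
            (assoc (tmul R (Res.val Φ.base s • muSC Φ y) s')) =
            op (Res.val Φ.base s') • Res.val Φ.base s •
              tensorSq Φ.base Φ.toHom Φ.map_smul Φ.map_op_smul y := by
        intro y
        induction y using induction_on with
        | zero => simp only [zero_tmul, map_zero, smul_zero]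
        | add x y hx hy => simp only [add_tmul, map_add, hx, hy, smul_add]
        | tmul c c' =>
          change tmul S (Res.val Φ.base s • Φ.toHom c)
            (op (Res.val Φ.base s') • (1 : S) • Φ.toHom c') = _
          rw [one_smul]; rfl
      rw [lambdaSCS_tmul, lambdaSC_tmul, h1, Φ.map_comul]
      change comul (op (Res.val Φ.base s') • Res.val Φ.base s • Φ.toHom c) = _
      rw [BimodHom.map_op_smul, BimodHom.map_smul]

theorem phiHat_rcolinear (x : SCS Φ) : comul (R := S) (phiHatBimod Φ x) =
    map (phiHatBimod Φ).right LinearMap.id (rhoSCS Φ x) := by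
  induction x using induction_on with
  | zero => simp only [map_zero]
  | add x y hx hy => simp only [map_add, hx, hy]
  | tmul x s' =>
    induction x using induction_on with
    | zero => simp only [zero_tmul, map_zero]
    | add x y hx hy => simp only [add_tmul, map_add, hx, hy]
    | tmul s c =>
      have h1 : ∀ y : BTensor R C C,
          map (phiHatBimod Φ).right LinearMap.id
            (op (Res.val Φ.base s') • muSCS Φ (assoc.symm (tmul R s y))) =
            op (Res.val Φ.base s') • Res.val Φ.base s •
              tensorSq Φ.base Φ.toHom Φ.map_smul Φ.map_op_smul y := by
        intro y
        induction y using induction_on with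
        | zero => simp only [tmul_zero, map_zero, smul_zero]
        | add x y hx hy => simp only [tmul_add, map_add, hx, hy, smul_add]
        | tmul c c' =>
          change tmul S (op (1 : S) • Res.val Φ.base s • Φ.toHom c)
            (op (Res.val Φ.base s') • Φ.toHom c') = _
          rw [MulOpposite.op_one, one_smul]; rfl
      rw [rhoSCS_tmul, rhoSC_tmul, h1, Φ.map_comul]
      change comul (op (Res.val Φ.base s') • Res.val Φ.base s • Φ.toHom c) = _
      rw [BimodHom.map_op_smul, BimodHom.map_smul]

/-- The `D`-bicomodule map `S ⊗_R C ⊗_R S → D`, `s ⊗ c ⊗ s' ↦ s Φ(c) s'`. -/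
def phiHat : bicomoduleSCS Φ ⟶ regularBicomodule S D :=
  (⟨phiHatBimod Φ, phiHat_lcolinear Φ, phiHat_rcolinear Φ⟩ :
    Bicomodule.Hom (bicomoduleSCS Φ) (regularBicomodule S D))

end Coactions

end Corings

/-!
Coinduction `G = - □_D (S ⊗_R C)` has a left adjoint, the induction functor `F = - ⊗_R S`, with
unit `m ↦ (m₀ ⊗ 1) ⊗ (1 ⊗ m₁)` and with counit `FGN → N` induced by
`n ⊗ s ⊗ c ⊗ s' ↦ n ε(s Φ(c) s')` (`inductionAdj`). A right adjoint is naturally full exactly when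
its counit is split, naturally, by some `ν : id → FG` with `ν` after the counit equal to the
identity (`naturallyFull_iff_of_adjunction`). It remains to compare such `ν` with retractions `Ψ`
of `Φ̂`. Both comparisons go through the map `cotensorIncl` from `FGN = (N □_D (S ⊗_R C)) ⊗_R S` to
`N ⊗_S (S ⊗_R C ⊗_R S)`, which is injective because `S` preserves the equalizer.

Given `Ψ`, its left colinearity shows that `n ↦ n₀ ⊗ Ψ(n₁)` satisfies the cotensor condition, so it
factors through `FGN`, again because `S` preserves the equalizer; this is `ν`. The counit followed
by the coaction of `N` is `(N ⊗ Φ̂) ∘ cotensorIncl` (`coact_counitLin`), which gives the splitting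
(`splittingLin_counitLin`). The counit is `cotensorIncl` followed by a contraction
`N ⊗_S (S ⊗_R C ⊗_R S) → N`, so the splitting makes `cotensorIncl` a split monomorphism of right
`S`-modules. It therefore stays injective after tensoring with `D`, and the colinearity of `ν` can
be tested in `N ⊗_S (S ⊗_R C ⊗_R S)`, although `D` is not assumed to preserve the equalizer.

Given `ν`, the map `Ψ` is `cotensorIncl` after the component of `ν` at `D`, contracted with the
counit of `D` (`splittingBimod`). Naturality of `ν` for left multiplications on `D` makes `Ψ` left
linear; naturality for the maps `d' ⊗ - : D → D ⊗_S D` and for the comultiplication `D → D ⊗_S D`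
makes it left colinear (`splittingBimod_lcolinear`).
-/

namespace Corings

open BTensor Coring

/-! ### Functoriality and contractions of balanced tensor products -/

namespace BTensor

variable {R S T M M' N N' P P' X : Type u} [Ring R] [Ring S] [Ring T]
  [AddCommGroup M] [Module Rᵐᵒᵖ M] [AddCommGroup M'] [Module Rᵐᵒᵖ M']
  [AddCommGroup N] [Module Sᵐᵒᵖ N] [AddCommGroup N'] [Module Sᵐᵒᵖ N']

/-- `f ⊗_S P` as a map of right `T`-modules, for an `(S, T)`-bimodule `P`. -/
def rTensor (P : Type u) [AddCommGroup P] [Module S P] [Module Tᵐᵒᵖ P] [SMulCommClass S Tᵐᵒᵖ P]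
    (f : N →ₗ[Sᵐᵒᵖ] N') : BTensor S N P →ₗ[Tᵐᵒᵖ] BTensor S N' P where
  toFun := map f LinearMap.id
  map_add' := map_add _
  map_smul' r x := map_op_smul' _ _ r (fun _ => rfl) x

section

variable [AddCommGroup P] [Module S P] [Module Tᵐᵒᵖ P] [SMulCommClass S Tᵐᵒᵖ P]

@[simp] theorem rTensor_apply (f : N →ₗ[Sᵐᵒᵖ] N') (x : BTensor S N P) :
    rTensor (T := T) P f x = map f LinearMap.id x := rfl

end

section contract

variable [AddCommGroup P] [Module S P] [Module Sᵐᵒᵖ P] [SMulCommClass S Sᵐᵒᵖ P]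

/-- For a bimodule map `α : P → S`, the contraction `N ⊗_S P → N`, `n ⊗ p ↦ n α(p)`. -/
def contractRight (N : Type u) [AddCommGroup N] [Module Sᵐᵒᵖ N] (α : BimodHom S S P S) :
    BTensor S N P →ₗ[Sᵐᵒᵖ] N where
  toFun x := rid S N (map LinearMap.id α.left x)
  map_add' x y := by rw [map_add, map_add]
  map_smul' s x := by
    induction x using induction_on with
    | zero => simp only [smul_zero, map_zero]
    | add x y hx hy => simp only [smul_add, map_add, hx, hy]
    | tmul n p =>
      change op (α (s • p)) • n = s • op (α p) • n
      rw [α.map_op_smul, ← mul_smul]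
      rfl

theorem contractRight_map (α : BimodHom S S P S) (f : N →ₗ[Sᵐᵒᵖ] N') (x : BTensor S N P) :
    contractRight N' α (map f LinearMap.id x) = f (contractRight N α x) := by
  induction x using induction_on with
  | zero => simp only [map_zero]
  | add x y hx hy => simp only [map_add, hx, hy]
  | tmul n p => exact (f.map_smul _ _).symm

/-- For a bimodule map `α : P → S`, the contraction `P ⊗_S X → X`, `p ⊗ x ↦ α(p) x`. -/
def contractLeft (X : Type u) [AddCommGroup X] [Module S X] (α : BimodHom S S P S) :
    BTensor S P X →ₗ[S] X where
  toFun x := lid S X (map α.right LinearMap.id x)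
  map_add' x y := by rw [map_add, map_add]
  map_smul' s x := by
    induction x using induction_on with
    | zero => simp only [smul_zero, map_zero]
    | add x y hx hy => simp only [smul_add, map_add, hx, hy]
    | tmul p x =>
      change α (s • p) • x = s • α p • x
      rw [α.map_smul, ← mul_smul]
      rfl

variable [AddCommGroup X] [Module S X]

theorem contractLeft_op_smul [Module Tᵐᵒᵖ X] [SMulCommClass S Tᵐᵒᵖ X] (α : BimodHom S S P S)
    (t : Tᵐᵒᵖ) (x : BTensor S P X) : contractLeft X α (t • x) = t • contractLeft X α x := by
  induction x using induction_on with
  | zero => simp only [smul_zero, map_zero]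
  | add x y hx hy => simp only [smul_add, map_add, hx, hy]
  | tmul p x => exact smul_comm _ _ _

theorem contractLeft_map [AddCommGroup P'] [Module S P'] (α : BimodHom S S P S) (f : X →ₗ[S] P')
    (x : BTensor S P X) : contractLeft P' α (map LinearMap.id f x) = f (contractLeft X α x) := by
  induction x using induction_on with
  | zero => simp only [map_zero]
  | add x y hx hy => simp only [map_add, hx, hy]
  | tmul p x => exact (f.map_smul _ _).symm

end contract

theorem injective_map_of_leftInverse [AddCommGroup P] [Module S P] (f : N →ₗ[Sᵐᵒᵖ] N')
    (r : N' →ₗ[Sᵐᵒᵖ] N) (h : ∀ x, r (f x) = x) :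
    Function.Injective (map f (LinearMap.id : P →ₗ[S] P)) := by
  refine Function.LeftInverse.injective (g := map r LinearMap.id) fun x => ?_
  rw [map_map, show r.comp f = LinearMap.id from LinearMap.ext h]
  exact map_id x

end BTensor

theorem RightComodule.hom_ext {R C : Type u} [Ring R] [AddCommGroup C] [Module R C]
    [Module Rᵐᵒᵖ C] [SMulCommClass R Rᵐᵒᵖ C] [Coring R C] {M N : RightComodule R C} {f g : M ⟶ N}
    (h : ∀ x, f.toLin x = g.toLin x) : f = g :=
  RightComodule.Hom.ext (LinearMap.ext h)

section Adjunction

variable {R S C D : Type u} [Ring R] [Ring S]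
  [AddCommGroup C] [Module R C] [Module Rᵐᵒᵖ C] [SMulCommClass R Rᵐᵒᵖ C] [Coring R C]
  [AddCommGroup D] [Module S D] [Module Sᵐᵒᵖ D] [SMulCommClass S Sᵐᵒᵖ D] [Coring S D]
  (Φ : CoringHom R S C D)

/-! ### The induction functor -/

section induction

variable (M : Type u) [AddCommGroup M] [Module Rᵐᵒᵖ M]

/-- The map `M ⊗_R C → (M ⊗_R S) ⊗_S D`, `m ⊗ c ↦ (m ⊗ 1) ⊗ Φ(c)`. -/
def inductionMu : BTensor R M C →+ BTensor S (BTensor R M (Res Φ.base)) D :=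
  lift (((BTensor.mk S).comp ((BTensor.mk R).flip (Res.of Φ.base 1))).compl₂ Φ.toHom)
    (fun r x c => by
      change tmul S (tmul R (op r • x) (Res.of Φ.base 1)) (Φ.toHom c) =
        tmul S (tmul R x (Res.of Φ.base 1)) (Φ.toHom (r • c))
      rw [Φ.map_smul, ← smul_tmul (Φ.base r), right_smul_tmul, smul_tmul, Res.op_smul_def,
        Res.base_smul_def, Res.val_of, mul_one, one_mul])

theorem inductionMu_op_smul (r : R) (y : BTensor R M C) :
    inductionMu Φ M (op r • y) = op (Φ.base r) • inductionMu Φ M y := by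
  induction y using induction_on with
  | zero => simp only [smul_zero, map_zero]
  | add x y hx hy => simp only [smul_add, map_add, hx, hy]
  | tmul x c =>
    change tmul S (tmul R x _) (Φ.toHom (op r • c)) = _
    rw [Φ.map_op_smul]
    rfl

variable {M} in
theorem inductionMu_map {M' : Type u} [AddCommGroup M'] [Module Rᵐᵒᵖ M'] (f : M →ₗ[Rᵐᵒᵖ] M')
    (y : BTensor R M C) :
    inductionMu Φ M' (map f LinearMap.id y) =
      map (rTensor (Res Φ.base) f) LinearMap.id (inductionMu Φ M y) := by
  induction y using induction_on with
  | zero => simp only [map_zero]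
  | add x y hx hy => simp only [map_add, hx, hy]
  | tmul x c => rfl

/-- The map `M ⊗_R C → (M ⊗_R S) ⊗_S (S ⊗_R C)`, `m ⊗ c ↦ (m ⊗ 1) ⊗ (1 ⊗ c)`. -/
def inductionTheta : BTensor R M C →ₗ[Rᵐᵒᵖ] BTensor S (BTensor R M (Res Φ.base)) (SC Φ) where
  toFun := lift (((BTensor.mk S).comp ((BTensor.mk R).flip (Res.of Φ.base 1))).compl₂
      (BTensor.mk R (Res.of Φ.base 1)))
    (fun r x c => by
      change tmul S (tmul R (op r • x) (Res.of Φ.base 1)) (tmul R (Res.of Φ.base 1) c) =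
        tmul S (tmul R x (Res.of Φ.base 1)) (tmul R (Res.of Φ.base 1) (r • c))
      -- Both sides equal `(x ⊗ φ(r)) ⊗ (1 ⊗ c) = (x ⊗ 1) ⊗ (φ(r) ⊗ c)`.
      have h := smul_tmul (Φ.base r) (tmul R x (Res.of Φ.base 1)) (tmul R (Res.of Φ.base 1) c)
      rw [left_smul_tmul, right_smul_tmul, Res.smul_def, Res.op_smul_def, Res.val_of, mul_one,
        one_mul] at h
      rw [← smul_tmul r (Res.of Φ.base 1), smul_tmul r x, Res.base_op_smul_def, Res.base_smul_def,
        Res.val_of, mul_one, one_mul]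
      exact h)
  map_add' := map_add _
  map_smul' r y := by
    induction y using induction_on with
    | zero => simp only [smul_zero, map_zero]
    | add x y hx hy => simp only [smul_add, map_add, hx, hy]
    | tmul x c => rfl

end induction

section inductionCoact

variable {M : Type u} [AddCommGroup M] [Module Rᵐᵒᵖ M]

/-- The right `D`-coaction `m ⊗ s ↦ (m₀ ⊗ 1) ⊗ Φ(m₁) s` on `M ⊗_R S`, for a right
`C`-coaction `ρ` on `M`. -/
def inductionCoact (ρ : M →ₗ[Rᵐᵒᵖ] BTensor R M C) : BTensor R M (Res Φ.base) →ₗ[Sᵐᵒᵖ]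
    BTensor S (BTensor R M (Res Φ.base)) D where
  toFun := lift (AddMonoidHom.mk' (fun x => AddMonoidHom.mk'
      (fun s => op (Res.val Φ.base s) • inductionMu Φ M (ρ x))
      (fun s s' => by rw [map_add, MulOpposite.op_add, add_smul]))
      (fun x x' => by
        ext s
        change op (Res.val Φ.base s) • inductionMu Φ M (ρ (x + x')) = _
        rw [map_add, map_add, smul_add]; rfl))
    (fun r x s => by
      change op (Res.val Φ.base s) • inductionMu Φ M (ρ (op r • x)) =
        op (Res.val Φ.base (r • s)) • inductionMu Φ M (ρ x)
      rw [LinearMap.map_smul, inductionMu_op_smul, Res.base_smul_def, Res.val_of,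
        MulOpposite.op_mul, mul_smul])
  map_add' := map_add _
  map_smul' t x := by
    induction x using induction_on with
    | zero => simp only [smul_zero, map_zero]
    | add x y hx hy => simp only [smul_add, map_add, hx, hy]
    | tmul x s =>
      change (t * op (Res.val Φ.base s)) • inductionMu Φ M (ρ x) =
        t • op (Res.val Φ.base s) • inductionMu Φ M (ρ x)
      rw [mul_smul]

theorem inductionCoact_tmul (ρ : M →ₗ[Rᵐᵒᵖ] BTensor R M C) (x : M) (s : Res Φ.base) :
    inductionCoact Φ ρ (tmul R x s) =
      op (Res.val Φ.base s) • inductionMu Φ M (ρ x) := rfl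

theorem inductionCoact_coassoc (ρ : M →ₗ[Rᵐᵒᵖ] BTensor R M C)
    (h : ∀ m, assoc (map ρ LinearMap.id (ρ m)) =
      map LinearMap.id (comul (R := R) (C := C)).left (ρ m))
    (x : BTensor R M (Res Φ.base)) :
    assoc (map (inductionCoact Φ ρ) LinearMap.id (inductionCoact Φ ρ x)) =
      map LinearMap.id (comul (R := S) (C := D)).left (inductionCoact Φ ρ x) := by
  induction x using induction_on with
  | zero => simp only [map_zero]
  | add x y hx hy => simp only [map_add, hx, hy]
  | tmul x s =>
    let sq : BTensor R C C →+ BTensor S D D :=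
      tensorSq Φ.base Φ.toHom Φ.map_smul Φ.map_op_smul
    have hsq : ∀ (r : R) (w : BTensor R C C), sq (r • w) = Φ.base r • sq w := by
      intro r w
      induction w using induction_on with
      | zero => simp only [smul_zero, map_zero]
      | add x y hx hy => simp only [smul_add, map_add, hx, hy]
      | tmul c c' =>
        change tmul S (Φ.toHom (r • c)) (Φ.toHom c') = _
        rw [Φ.map_smul]; rfl
    let b : BTensor R M (BTensor R C C) →+
        BTensor S (BTensor R M (Res Φ.base)) (BTensor S D D) :=
      lift (((BTensor.mk S).comp ((BTensor.mk R).flip (Res.of Φ.base 1))).compl₂ sq)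
        (fun r x w => by
          change tmul S (tmul R (op r • x) (Res.of Φ.base 1)) (sq w) =
            tmul S (tmul R x (Res.of Φ.base 1)) (sq (r • w))
          rw [hsq, ← smul_tmul (Φ.base r), right_smul_tmul, smul_tmul, Res.op_smul_def,
            Res.base_smul_def, Res.val_of, mul_one, one_mul])
    have h1 : ∀ y : BTensor R M C,
        assoc (map (inductionCoact Φ ρ) LinearMap.id (inductionMu Φ M y)) =
          b (assoc (map ρ LinearMap.id y)) := by
      intro y
      induction y using induction_on with
      | zero => simp only [map_zero]
      | add x y hx hy => simp only [map_add, hx, hy]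
      | tmul p c =>
        change assoc (tmul S (op (1 : S) • inductionMu Φ M (ρ p)) (Φ.toHom c)) =
          b (assoc (tmul R (ρ p) c))
        rw [MulOpposite.op_one, one_smul]
        generalize ρ p = z
        induction z using induction_on with
        | zero => simp only [zero_tmul, map_zero]
        | add x y hx hy => simp only [add_tmul, map_add, hx, hy]
        | tmul p c => rfl
    have h2 : ∀ y : BTensor R M C,
        map LinearMap.id (comul (R := S) (C := D)).left (inductionMu Φ M y) =
          b (map LinearMap.id (comul (R := R) (C := C)).left y) := by
      intro y
      induction y using induction_on with
      | zero => simp only [map_zero]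
      | add x y hx hy => simp only [map_add, hx, hy]
      | tmul p c =>
        change tmul S (tmul R p (Res.of Φ.base 1)) (comul (Φ.toHom c)) =
          tmul S (tmul R p (Res.of Φ.base 1)) (sq (comul c))
        rw [← Φ.map_comul]
    rw [inductionCoact_tmul, map_op_smul' _ _ _ (fun _ => rfl), assoc_op_smul, h1,
      map_op_smul' _ _ _ (BimodHom.map_op_smul _ _), h2, h]

theorem inductionCoact_counit (ρ : M →ₗ[Rᵐᵒᵖ] BTensor R M C)
    (h : ∀ m, rid R M (map LinearMap.id (counit (R := R) (C := C)).left (ρ m)) = m)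
    (x : BTensor R M (Res Φ.base)) :
    rid S _ (map LinearMap.id (counit (R := S) (C := D)).left (inductionCoact Φ ρ x)) = x := by
  induction x using induction_on with
  | zero => simp only [map_zero]
  | add x y hx hy => simp only [map_add, hx, hy]
  | tmul x s =>
    have h1 : ∀ y : BTensor R M C,
        rid S _ (map LinearMap.id (counit (R := S) (C := D)).left
          (op (Res.val Φ.base s) • inductionMu Φ M y)) =
          tmul R (rid R _ (map LinearMap.id (counit (R := R) (C := C)).left y)) s := by
      intro y
      induction y using induction_on with
      | zero => simp only [zero_tmul, smul_zero, map_zero]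
      | add x y hx hy => simp only [add_tmul, smul_add, map_add, hx, hy]
      | tmul p c =>
        change tmul R p (op (counit (R := S) (op (Res.val Φ.base s) • Φ.toHom c)) •
          Res.of Φ.base 1) = tmul R (op (counit (R := R) c) • p) s
        rw [smul_tmul, BimodHom.map_op_smul, ← Φ.map_counit, Res.op_smul_def, Res.val_of, one_mul,
          Res.base_smul_def]
        rfl
    rw [inductionCoact_tmul, h1, h]

end inductionCoact

/-- The right `D`-comodule `M ⊗_R S` induced from a right `C`-comodule `M`. -/
def inductionComodule (M : RightComodule R C) : RightComodule S D where
  carrier := BTensor R M.carrier (Res Φ.base)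
  coact := inductionCoact Φ M.coact
  coassoc := inductionCoact_coassoc Φ M.coact M.coassoc
  coact_counit := inductionCoact_counit Φ M.coact M.coact_counit

/-- The colinear map `f ⊗_R S` for a colinear map `f`. -/
def inductionMap {M M' : RightComodule R C} (f : M ⟶ M') :
    RightComodule.Hom (inductionComodule Φ M) (inductionComodule Φ M') where
  toLin := rTensor (Res Φ.base) f.toLin
  colinear x := by
    change inductionCoact Φ M'.coact (map f.toLin LinearMap.id x) =
      map _ LinearMap.id (inductionCoact Φ M.coact x)
    induction x using induction_on with
    | zero => simp only [map_zero]
    | add x y hx hy => simp only [map_add, hx, hy]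
    | tmul x s =>
      rw [map_tmul, inductionCoact_tmul, inductionCoact_tmul, map_op_smul' _ _ _ (fun _ => rfl),
        f.colinear, inductionMu_map]
      rfl

/-- The induction functor `- ⊗_R S` from right `C`-comodules to right `D`-comodules. -/
def induction : RightComodule R C ⥤ RightComodule S D where
  obj M := inductionComodule Φ M
  map f := inductionMap Φ f
  map_id _ := RightComodule.hom_ext fun x => BTensor.map_id x
  map_comp f g := RightComodule.hom_ext fun x =>
    (BTensor.map_map (R := R) g.toLin LinearMap.id f.toLin LinearMap.id x).symm

/-! ### The unit of the adjunction between induction and coinduction -/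

theorem inductionTheta_map {M M' : Type u} [AddCommGroup M] [Module Rᵐᵒᵖ M]
    [AddCommGroup M'] [Module Rᵐᵒᵖ M'] (f : M →ₗ[Rᵐᵒᵖ] M') (y : BTensor R M C) :
    inductionTheta Φ M' (map f LinearMap.id y) =
      map (rTensor (Res Φ.base) f) LinearMap.id (inductionTheta Φ M y) := by
  induction y using induction_on with
  | zero => simp only [map_zero]
  | add x y hx hy => simp only [map_add, hx, hy]
  | tmul x c => rfl

/-- The values `(m₀ ⊗ 1) ⊗ (1 ⊗ m₁)` of the unit lie in the cotensor product, by coassociativity. -/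
theorem inductionTheta_coact_mem (M : RightComodule R C) (m : M.carrier) :
    inductionTheta Φ M.carrier (M.coact m) ∈ cotensor Φ (inductionComodule Φ M) := by
  let F : BTensor R M.carrier (BTensor R C C) →+
      BTensor S (BTensor R M.carrier (Res Φ.base)) (BTensor S D (SC Φ)) :=
    lift (((BTensor.mk S).comp ((BTensor.mk R).flip (Res.of Φ.base 1))).compl₂ (muSC Φ))
      (fun r x w => by
        change tmul S (tmul R (op r • x) (Res.of Φ.base 1)) (muSC Φ w) =
          tmul S (tmul R x (Res.of Φ.base 1)) (muSC Φ (r • w))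
        rw [muSC_smul, ← smul_tmul (Φ.base r), right_smul_tmul, smul_tmul, Res.op_smul_def,
          Res.base_smul_def, Res.val_of, mul_one, one_mul])
  have h1 : ∀ y : BTensor R M.carrier C,
      map (inductionCoact Φ M.coact) LinearMap.id (inductionTheta Φ M.carrier y) =
        assoc.symm (F (assoc (map M.coact LinearMap.id y))) := by
    intro y
    induction y using induction_on with
    | zero => simp only [map_zero]
    | add x y hx hy => simp only [map_add, hx, hy]
    | tmul x c =>
      change tmul S (op (1 : S) • inductionMu Φ M.carrier (M.coact x))
        (tmul R (Res.of Φ.base 1) c) = assoc.symm (F (assoc (tmul R (M.coact x) c)))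
      rw [MulOpposite.op_one, one_smul]
      generalize M.coact x = z
      induction z using induction_on with
      | zero => simp only [zero_tmul, map_zero]
      | add x y hx hy => simp only [add_tmul, map_add, hx, hy]
      | tmul p c => rfl
  have h2 : ∀ y : BTensor R M.carrier C,
      assoc.symm (map LinearMap.id (lambdaSC Φ).left (inductionTheta Φ M.carrier y)) =
        assoc.symm (F (map LinearMap.id (comul (R := R) (C := C)).left y)) := by
    intro y
    induction y using induction_on with
    | zero => simp only [map_zero]
    | add x y hx hy => simp only [map_add, hx, hy]
    | tmul x c =>
      change assoc.symm (tmul S (tmul R x (Res.of Φ.base 1)) ((1 : S) • muSC Φ (comul c))) = _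
      rw [one_smul]
      rfl
  exact (h1 _).trans ((congrArg _ (congrArg F (M.coassoc m))).trans (h2 _).symm)

/-- The unit `m ↦ (m₀ ⊗ 1) ⊗ (1 ⊗ m₁)` as a linear map. -/
def unitLin (M : RightComodule R C) :
    M.carrier →ₗ[Rᵐᵒᵖ] cotensor Φ (inductionComodule Φ M) :=
  ((inductionTheta Φ M.carrier).comp M.coact).codRestrict _ (inductionTheta_coact_mem Φ M)

theorem lTensorCoact_inductionTheta {M : Type u} [AddCommGroup M] [Module Rᵐᵒᵖ M]
    (y : BTensor R M C) :
    lTensorCoact _ (rhoSC Φ) (inductionTheta Φ M y) =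
      map (inductionTheta Φ M) LinearMap.id
        (assoc.symm (map LinearMap.id (comul (R := R) (C := C)).left y)) := by
  induction y using induction_on with
  | zero => simp only [map_zero]
  | add x y hx hy => simp only [map_add, hx, hy]
  | tmul x c =>
    change assoc.symm (tmul S (tmul R x (Res.of Φ.base 1))
      (assoc.symm (tmul R (Res.of Φ.base 1) (comul c)))) =
      map (inductionTheta Φ M) LinearMap.id (assoc.symm (tmul R x (comul c)))
    generalize (comul c : BTensor R C C) = z
    induction z using induction_on with
    | zero => simp only [tmul_zero, map_zero]
    | add x y hx hy => simp only [tmul_add, map_add, hx, hy]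
    | tmul p c => rfl

variable (hCC : PreservesCotensor Φ (BTensor R C C))

/-- The unit `m ↦ (m₀ ⊗ 1) ⊗ (1 ⊗ m₁)` of the adjunction. -/
noncomputable def unitHom (M : RightComodule R C) :
    RightComodule.Hom M (cotensorComodule Φ hCC (inductionComodule Φ M)) where
  toLin := unitLin Φ M
  colinear m := by
    apply (hCC.of_tensor (inductionComodule Φ M)).1
    refine (cotensorCoact_spec Φ hCC.of_tensor _ _).trans ?_
    refine Eq.trans ?_ (map_map _ _ _ _ _).symm
    refine (lTensorCoact_inductionTheta Φ (M.coact m)).trans ?_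
    rw [← M.coassoc, AddEquiv.symm_apply_apply, map_map]
    rfl

/-- The unit of the adjunction as a natural transformation. -/
noncomputable def unitNat : 𝟭 (RightComodule R C) ⟶ induction Φ ⋙ coinduction Φ hCC where
  app M := unitHom Φ hCC M
  naturality M M' f := RightComodule.hom_ext fun m => by
    apply Subtype.ext
    change inductionTheta Φ M'.carrier (M'.coact (f.toLin m)) =
      map (rTensor (Res Φ.base) f.toLin) LinearMap.id (inductionTheta Φ M.carrier (M.coact m))
    rw [f.colinear, inductionTheta_map]

/-! ### The counit of the adjunction -/

section assocSCS

variable (N : Type u) [AddCommGroup N] [Module Sᵐᵒᵖ N]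

/-- The associativity map `(N ⊗_S (S ⊗_R C)) ⊗_R S → N ⊗_S (S ⊗_R C ⊗_R S)`. -/
def assocSCS : BTensor R (BTensor S N (SC Φ)) (Res Φ.base) →ₗ[Sᵐᵒᵖ] BTensor S N (SCS Φ) where
  toFun x := assoc x
  map_add' := map_add _
  map_smul' s x := assoc_op_smul s x

theorem assocSCS_inductionMu (x : BTensor S N (SC Φ)) :
    map (assocSCS Φ N) (LinearMap.id : D →ₗ[S] D)
        (inductionMu Φ _ (lTensorCoact N (rhoSC Φ) x)) =
      lTensorCoact N (rhoSCS Φ) (assoc (tmul R x (Res.of Φ.base 1))) := by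
  induction x using induction_on with
  | zero => simp only [zero_tmul, map_zero]
  | add x y hx hy => simp only [add_tmul, map_add, hx, hy]
  | tmul n l =>
    change map (assocSCS Φ N) (LinearMap.id : D →ₗ[S] D)
        (inductionMu Φ _ (assoc.symm (tmul S n (rhoSC Φ l)))) =
      assoc.symm (tmul S n (op (1 : S) • muSCS Φ (rhoSC Φ l)))
    rw [MulOpposite.op_one, one_smul]
    generalize rhoSC Φ l = y
    induction y using induction_on with
    | zero => simp only [tmul_zero, map_zero]
    | add x y hx hy => simp only [tmul_add, map_add, hx, hy]
    | tmul p c => rfl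

end assocSCS

/-- The map `(N □_D (S ⊗_R C)) ⊗_R S → N ⊗_S (S ⊗_R C ⊗_R S)` induced by the inclusion. -/
def cotensorIncl (N : RightComodule S D) :
    BTensor R (cotensor Φ N) (Res Φ.base) →ₗ[Sᵐᵒᵖ] BTensor S N.carrier (SCS Φ) :=
  (assocSCS Φ N.carrier).comp (rTensor (Res Φ.base) (cotensor Φ N).subtype)

theorem cotensorIncl_tmul (N : RightComodule S D) (k : cotensor Φ N) (s : Res Φ.base) :
    cotensorIncl Φ N (tmul R k s) = assoc (tmul R k.1 s) := rfl

/-- `cotensorIncl` is right `D`-colinear for the coaction `N ⊗_S rhoSCS` on its target. -/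
theorem cotensorIncl_colinear (N : RightComodule S D)
    (z : BTensor R (cotensor Φ N) (Res Φ.base)) :
    map (cotensorIncl Φ N) LinearMap.id (inductionCoact Φ (cotensorCoact Φ hCC.of_tensor N) z) =
      lTensorCoact N.carrier (rhoSCS Φ) (cotensorIncl Φ N z) := by
  induction z using induction_on with
  | zero => simp only [map_zero]
  | add x y hx hy => simp only [map_add, hx, hy]
  | tmul k s =>
    have h := assocSCS_inductionMu Φ N.carrier k.1
    rw [← cotensorCoact_spec Φ hCC.of_tensor N k, inductionMu_map, map_map] at h
    rw [inductionCoact_tmul, map_op_smul' _ _ _ (fun _ => rfl)]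
    refine (congrArg _ h).trans ?_
    rw [← LinearMap.map_smul, ← assoc_op_smul, cotensorIncl_tmul, right_smul_tmul,
      Res.op_smul_def, Res.val_of, one_mul, Res.of_val]

theorem map_coact_assoc (N : RightComodule S D)
    (x : BTensor R (BTensor S N.carrier (SC Φ)) (Res Φ.base)) :
    map N.coact LinearMap.id (assoc x) = assoc (map (cotensorLeft Φ N) LinearMap.id x) := by
  induction x using induction_on with
  | zero => simp only [map_zero]
  | add x y hx hy => simp only [map_add, hx, hy]
  | tmul x s =>
    induction x using induction_on with
    | zero => simp only [zero_tmul, map_zero]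
    | add x y hx hy => simp only [add_tmul, map_add, hx, hy]
    | tmul n l => rfl

theorem map_lambdaSCS_assoc (N : RightComodule S D)
    (x : BTensor R (BTensor S N.carrier (SC Φ)) (Res Φ.base)) :
    assoc.symm (map LinearMap.id (lambdaSCS Φ).left (assoc x)) =
      assoc (map (cotensorRight Φ N) LinearMap.id x) := by
  induction x using induction_on with
  | zero => simp only [map_zero]
  | add x y hx hy => simp only [map_add, hx, hy]
  | tmul x s =>
    induction x using induction_on with
    | zero => simp only [zero_tmul, map_zero]
    | add x y hx hy => simp only [add_tmul, map_add, hx, hy]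
    | tmul n l =>
      change assoc.symm (tmul S n (assoc (tmul R (lambdaSC Φ l) s))) =
        assoc (tmul R (assoc.symm (tmul S n (lambdaSC Φ l))) s)
      generalize lambdaSC Φ l = y
      induction y using induction_on with
      | zero => simp only [zero_tmul, tmul_zero, map_zero]
      | add x y hx hy => simp only [add_tmul, tmul_add, map_add, hx, hy]
      | tmul d l => rfl

/-- The image of `(N □_D (S ⊗_R C)) ⊗_R S` satisfies the cotensor condition over
`S ⊗_R C ⊗_R S`. -/
theorem cotensorIncl_equalizes (N : RightComodule S D)
    (z : BTensor R (cotensor Φ N) (Res Φ.base)) :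
    map N.coact LinearMap.id (cotensorIncl Φ N z) =
      assoc.symm (map LinearMap.id (lambdaSCS Φ).left (cotensorIncl Φ N z)) := by
  have h : (cotensorLeft Φ N).comp (cotensor Φ N).subtype =
      (cotensorRight Φ N).comp (cotensor Φ N).subtype := LinearMap.ext fun k => k.2
  refine (map_coact_assoc Φ N _).trans (Eq.trans ?_ (map_lambdaSCS_assoc Φ N _).symm)
  rw [rTensor_apply, map_map, map_map, h]

/-- `cotensorIncl` is natural in the comodule. -/
theorem cotensorIncl_map {N N' : RightComodule S D} (f : N ⟶ N')
    (z : BTensor R (cotensor Φ N) (Res Φ.base)) :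
    cotensorIncl Φ N' (map ((ambientMap Φ f).restrict (ambientMap_mem Φ f)) LinearMap.id z) =
      map f.toLin LinearMap.id (cotensorIncl Φ N z) := by
  induction z using induction_on with
  | zero => simp only [map_zero]
  | add x y hx hy => simp only [map_add, hx, hy]
  | tmul k s =>
    have h1 : ∀ x : BTensor S N.carrier (SC Φ),
        assoc (tmul R (map f.toLin LinearMap.id x) s) =
          map f.toLin (LinearMap.id : SCS Φ →ₗ[S] SCS Φ) (assoc (tmul R x s)) := by
      intro x
      induction x using induction_on with
      | zero => simp only [zero_tmul, map_zero]
      | add x y hx hy => simp only [add_tmul, map_add, hx, hy]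
      | tmul n l => rfl
    exact h1 k.1

/-- The map `S ⊗_R C ⊗_R S → S`, `s ⊗ c ⊗ s' ↦ ε(s Φ(c) s')`. -/
def counitSCS : BimodHom S S (SCS Φ) S := (counit (R := S) (C := D)).comp (phiHatBimod Φ)

theorem contractRight_lambdaSCS (p : SCS Φ) :
    contractRight D (counitSCS Φ) (lambdaSCS Φ p) = phiHatBimod Φ p := by
  refine Eq.trans ?_ (comul_counit (R := S) (phiHatBimod Φ p))
  rw [phiHat_lcolinear, map_map]
  rfl

theorem contractLeft_rhoSCS (p : SCS Φ) :
    contractLeft D (counitSCS Φ) (rhoSCS Φ p) = phiHatBimod Φ p := by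
  refine Eq.trans ?_ (counit_comul (R := S) (phiHatBimod Φ p))
  rw [phiHat_rcolinear, map_map]
  rfl

/-- The coaction of the contraction of an element of `N ⊗_S (S ⊗_R C ⊗_R S)` satisfying the
cotensor condition: that condition trades the coaction of `N` for the left coaction of
`S ⊗_R C ⊗_R S`, whose contraction is `Φ̂`. -/
theorem coact_contractRight (N : RightComodule S D) (y : BTensor S N.carrier (SCS Φ))
    (hy : map N.coact LinearMap.id y = assoc.symm (map LinearMap.id (lambdaSCS Φ).left y)) :
    N.coact (contractRight N.carrier (counitSCS Φ) y) =
      map LinearMap.id (phiHatBimod Φ).left y := by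
  rw [← contractRight_map, hy]
  clear hy
  induction y using induction_on with
  | zero => simp only [map_zero]
  | add x y hx hy => simp only [map_add, hx, hy]
  | tmul n p =>
    have h : ∀ z : BTensor S D (SCS Φ),
        contractRight (BTensor S N.carrier D) (counitSCS Φ) (assoc.symm (tmul S n z)) =
          tmul S n (contractRight D (counitSCS Φ) z) := by
      intro z
      induction z using induction_on with
      | zero => simp only [tmul_zero, map_zero]
      | add x y hx hy => simp only [tmul_add, map_add, hx, hy]
      | tmul d q => rfl
    exact (h _).trans (congrArg (tmul S n) (contractRight_lambdaSCS Φ p))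

theorem contractRight_lTensorCoact {N : Type u} [AddCommGroup N] [Module Sᵐᵒᵖ N]
    (y : BTensor S N (SCS Φ)) :
    map (contractRight N (counitSCS Φ)) LinearMap.id (lTensorCoact N (rhoSCS Φ) y) =
      map LinearMap.id (phiHatBimod Φ).left y := by
  induction y using induction_on with
  | zero => simp only [map_zero]
  | add x y hx hy => simp only [map_add, hx, hy]
  | tmul n p =>
    have h : ∀ z : BTensor S (SCS Φ) D,
        map (contractRight N (counitSCS Φ)) LinearMap.id (assoc.symm (tmul S n z)) =
          tmul S n (contractLeft D (counitSCS Φ) z) := by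
      intro z
      induction z using induction_on with
      | zero => simp only [tmul_zero, map_zero]
      | add x y hx hy => simp only [tmul_add, map_add, hx, hy]
      | tmul q d => exact smul_tmul _ _ _
    rw [lTensorCoact_tmul, h, contractLeft_rhoSCS]
    rfl

/-- The counit of the adjunction as a linear map, induced by `n ⊗ s ⊗ c ⊗ s' ↦ n ε(s Φ(c) s')`. -/
def counitLin (N : RightComodule S D) :
    BTensor R (cotensor Φ N) (Res Φ.base) →ₗ[Sᵐᵒᵖ] N.carrier :=
  (contractRight N.carrier (counitSCS Φ)).comp (cotensorIncl Φ N)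

theorem coact_counitLin (N : RightComodule S D) (z : BTensor R (cotensor Φ N) (Res Φ.base)) :
    N.coact (counitLin Φ N z) = map LinearMap.id (phiHatBimod Φ).left (cotensorIncl Φ N z) :=
  coact_contractRight Φ N _ (cotensorIncl_equalizes Φ N z)

/-- The counit of the adjunction, induced by `n ⊗ s ⊗ c ⊗ s' ↦ n ε(s Φ(c) s')`. -/
noncomputable def counitHom (N : RightComodule S D) :
    RightComodule.Hom (inductionComodule Φ (cotensorComodule Φ hCC N)) N where
  toLin := counitLin Φ N
  colinear z := by
    refine (coact_counitLin Φ N z).trans ?_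
    rw [← contractRight_lTensorCoact]
    refine (congrArg _ (cotensorIncl_colinear Φ hCC N z).symm).trans ?_
    exact map_map _ _ _ _ _

/-- The counit of the adjunction as a natural transformation. -/
noncomputable def counitNat : coinduction Φ hCC ⋙ induction Φ ⟶ 𝟭 (RightComodule S D) where
  app N := counitHom Φ hCC N
  naturality N N' f := RightComodule.hom_ext fun z => by
    refine (congrArg (contractRight N'.carrier (counitSCS Φ)) (cotensorIncl_map Φ f z)).trans ?_
    exact contractRight_map _ _ _

/-- The triangle identity at `GN`, read in `N ⊗_S (S ⊗_R C)`. -/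
theorem unit_counit_coinduction (N : RightComodule S D) (k : cotensor Φ N) :
    map (counitLin Φ N) (LinearMap.id : SC Φ →ₗ[S] SC Φ)
      (inductionTheta Φ (cotensor Φ N) (cotensorCoact Φ hCC.of_tensor N k)) = k.1 := by
  let β : BTensor R (BTensor S N.carrier (SC Φ)) (Res Φ.base) →ₗ[Sᵐᵒᵖ] N.carrier :=
    (contractRight N.carrier (counitSCS Φ)).comp (assocSCS Φ N.carrier)
  -- The contraction is defined on all of `N ⊗_S (S ⊗_R C)`, and the identity already holds there.
  have h0 : counitLin Φ N = β.comp (rTensor (Res Φ.base) (cotensor Φ N).subtype) := rfl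
  have h1 : ∀ x : BTensor S N.carrier (SC Φ),
      map β (LinearMap.id : SC Φ →ₗ[S] SC Φ)
        (inductionTheta Φ _ (lTensorCoact N.carrier (rhoSC Φ) x)) = x := by
    intro x
    induction x using induction_on with
    | zero => simp only [map_zero]
    | add x y hx hy => simp only [map_add, hx, hy]
    | tmul n l =>
      induction l using induction_on with
      | zero => simp only [tmul_zero, map_zero]
      | add x y hx hy => simp only [tmul_add, map_add, hx, hy]
      | tmul s c =>
        have h2 : ∀ y : BTensor R C C,
            map β (LinearMap.id : SC Φ →ₗ[S] SC Φ)
              (inductionTheta Φ _ (assoc.symm (tmul S n (assoc.symm (tmul R s y))))) =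
              tmul S n (tmul R s (lid R C (map counit.right LinearMap.id y))) := by
          intro y
          induction y using induction_on with
          | zero => simp only [tmul_zero, map_zero]
          | add x y hx hy => simp only [tmul_add, map_add, hx, hy]
          | tmul c c' =>
            change tmul S (op (counit (R := S) (op (1 : S) • Res.val Φ.base s • Φ.toHom c)) • n)
              (tmul R (Res.of Φ.base 1) c') = tmul S n (tmul R s (counit (R := R) c • c'))
            rw [MulOpposite.op_one, one_smul, smul_tmul, left_smul_tmul, ← smul_tmul (R := R),
              BimodHom.map_smul, ← Φ.map_counit, Res.smul_def, Res.val_of, mul_one,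
              Res.base_op_smul_def]
            rfl
        rw [lTensorCoact_tmul, rhoSC_tmul, h2, Coring.counit_comul]
  rw [h0, ← LinearMap.id_comp (LinearMap.id : SC Φ →ₗ[S] SC Φ), ← map_map, ← inductionTheta_map,
    cotensorCoact_spec]
  exact h1 k.1

/-- The triangle identity at `FM`. -/
theorem induction_unit_counit (M : RightComodule R C) (x : BTensor R M.carrier (Res Φ.base)) :
    counitLin Φ (inductionComodule Φ M) (map (unitLin Φ M) LinearMap.id x) = x := by
  induction x using induction_on with
  | zero => simp only [map_zero]; rfl
  | add x y hx hy => simp only [map_add, hx, hy]; rfl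
  | tmul m s =>
    have h1 : ∀ y : BTensor R M.carrier C,
        contractRight (BTensor R M.carrier (Res Φ.base)) (counitSCS Φ)
          (assoc (tmul R (inductionTheta Φ M.carrier y) s)) =
          tmul R (rid R M.carrier (map LinearMap.id (counit (R := R) (C := C)).left y)) s := by
      intro y
      induction y using induction_on with
      | zero => simp only [zero_tmul, map_zero]
      | add x y hx hy => simp only [add_tmul, map_add, hx, hy]
      | tmul m c =>
        change op (counit (R := S) (op (Res.val Φ.base s) • (1 : S) • Φ.toHom c)) •
          tmul R m (Res.of Φ.base 1) = tmul R (op (counit (R := R) c) • m) s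
        rw [one_smul, BimodHom.map_op_smul, ← Φ.map_counit, right_smul_tmul, smul_tmul,
          Res.op_smul_def, Res.val_of, one_mul, Res.base_smul_def]
        rfl
    refine (h1 (M.coact m)).trans ?_
    rw [M.coact_counit]

/-- Induction is left adjoint to coinduction. -/
noncomputable def inductionAdj : induction Φ ⊣ coinduction Φ hCC :=
  Adjunction.mkOfUnitCounit
    { unit := unitNat Φ hCC
      counit := counitNat Φ hCC
      left_triangle := by
        ext M
        exact RightComodule.hom_ext (induction_unit_counit Φ M)
      right_triangle := by
        ext N
        exact RightComodule.hom_ext fun k =>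
          Subtype.ext (unit_counit_coinduction Φ hCC N k) }

end Adjunction

/-! ### Natural fullness of a right adjoint -/

/-- A right adjoint is naturally full exactly when the counit of the adjunction is a naturally
split monomorphism. -/
theorem naturallyFull_iff_of_adjunction {𝒜 : Type*} [Category 𝒜] {ℬ : Type*} [Category ℬ]
    {F : ℬ ⥤ 𝒜} {G : 𝒜 ⥤ ℬ} (adj : F ⊣ G) :
    NaturallyFull G ↔
      ∃ ν : 𝟭 𝒜 ⟶ G ⋙ F, ∀ X, adj.counit.app X ≫ ν.app X = 𝟙 (F.obj (G.obj X)) := by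
  constructor
  · rintro ⟨p, hp, hGp⟩
    refine ⟨{ app := fun X => p X (F.obj (G.obj X)) (adj.unit.app (G.obj X)), naturality := ?_ },
      fun X => ?_⟩
    · intro X Y f
      have h1 := hp f (adj.unit.app (G.obj Y)) (𝟙 _)
      have h2 := hp (𝟙 X) (adj.unit.app (G.obj X)) (F.map (G.map f))
      rw [G.map_id, Category.comp_id, Category.comp_id] at h1
      rw [G.map_id, Category.id_comp, Category.id_comp] at h2
      have h3 := adj.unit.naturality (G.map f)
      simp only [Functor.id_map, Functor.comp_map] at h3
      exact h1.symm.trans ((congrArg (p X _) h3).trans h2)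
    · -- The transpose of `counit ≫ ν` is `unit ≫ G(counit) ≫ unit`, which is `unit`.
      apply (adj.homEquiv _ _).injective
      have h := hGp X (F.obj (G.obj X)) (adj.unit.app (G.obj X))
      simp [Adjunction.homEquiv_unit, h]
  · rintro ⟨ν, hν⟩
    refine ⟨fun X Y g => ν.app X ≫ F.map g ≫ adj.counit.app Y, fun f g h => ?_, fun X Y g => ?_⟩
    · have h1 := ν.naturality f
      simp only [Functor.id_map, Functor.comp_map] at h1
      simp only [Functor.map_comp, Category.assoc, Adjunction.counit_naturality]
      rw [← reassoc_of% h1]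
    · -- Since `unit ≫ G(counit) = 𝟙` and `G(counit) ≫ G(ν) = 𝟙`, the map `G(ν)` is the unit.
      have h1 : G.map (ν.app X) = adj.unit.app (G.obj X) := by
        have h2 := congrArg (fun f => adj.unit.app (G.obj X) ≫ G.map f) (hν X)
        simpa using h2
      simp [h1]

section Main

variable {R S C D : Type u} [Ring R] [Ring S]
  [AddCommGroup C] [Module R C] [Module Rᵐᵒᵖ C] [SMulCommClass R Rᵐᵒᵖ C] [Coring R C]
  [AddCommGroup D] [Module S D] [Module Sᵐᵒᵖ D] [SMulCommClass S Sᵐᵒᵖ D] [Coring S D]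
  (Φ : CoringHom R S C D)

/-! ### From a retraction of bicomodules to a splitting of the counit -/

section ofRetraction

variable {Φ} (Ψ : regularBicomodule S D ⟶ bicomoduleSCS Φ)

/-- The map underlying a homomorphism of bicomodules `D → S ⊗_R C ⊗_R S`. -/
def retractionBimod : BimodHom S S D (SCS Φ) := Ψ.toBimodHom

theorem retraction_lcolinear (d : D) : lambdaSCS Φ (retractionBimod Ψ d) =
    map LinearMap.id (retractionBimod Ψ).left (comul (R := S) d) := Ψ.lcolinear d

theorem retraction_rcolinear (d : D) : rhoSCS Φ (retractionBimod Ψ d) =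
    map (retractionBimod Ψ).right LinearMap.id (comul (R := S) d) := Ψ.rcolinear d

/-- The map `N ⊗_S Ψ : N ⊗_S D → N ⊗_S (S ⊗_R C ⊗_R S)`. -/
def lTensorRetraction (N : Type u) [AddCommGroup N] [Module Sᵐᵒᵖ N] :
    BTensor S N D →ₗ[Sᵐᵒᵖ] BTensor S N (SCS Φ) where
  toFun := map LinearMap.id (retractionBimod Ψ).left
  map_add' := map_add _
  map_smul' s x := map_op_smul' _ _ _ ((retractionBimod Ψ).map_op_smul s) x

/-- The map `N → N ⊗_S (S ⊗_R C ⊗_R S)`, `n ↦ n₀ ⊗ Ψ(n₁)`. -/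
def coactRetraction (N : RightComodule S D) : N.carrier →ₗ[Sᵐᵒᵖ] BTensor S N.carrier (SCS Φ) :=
  (lTensorRetraction Ψ N.carrier).comp N.coact

/-- Left colinearity of `Ψ` makes `n₀ ⊗ Ψ(n₁)` satisfy the cotensor condition. -/
theorem coactRetraction_equalizes (N : RightComodule S D) (n : N.carrier) :
    map N.coact LinearMap.id (coactRetraction Ψ N n) =
      assoc.symm (map LinearMap.id (lambdaSCS Φ).left (coactRetraction Ψ N n)) := by
  have h1 : ∀ y : BTensor S N.carrier D,
      map N.coact LinearMap.id (lTensorRetraction Ψ N.carrier y) =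
        lTensorRetraction Ψ _ (map N.coact (LinearMap.id : D →ₗ[S] D) y) := by
    intro y
    change map _ _ (map _ _ y) = map _ _ (map _ _ y)
    rw [map_map, map_map]
    rfl
  have h2 : ∀ y : BTensor S N.carrier D,
      assoc.symm (map LinearMap.id (lambdaSCS Φ).left (lTensorRetraction Ψ N.carrier y)) =
        lTensorRetraction Ψ _
          (assoc.symm (map LinearMap.id (comul (R := S) (C := D)).left y)) := by
    intro y
    induction y using induction_on with
    | zero => simp only [map_zero]
    | add x y hx hy => simp only [map_add, hx, hy]
    | tmul n d =>
      change assoc.symm (tmul S n (lambdaSCS Φ (retractionBimod Ψ d))) =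
        lTensorRetraction Ψ _ (assoc.symm (tmul S n (comul d)))
      rw [retraction_lcolinear]
      generalize (comul d : BTensor S D D) = z
      induction z using induction_on with
      | zero => simp only [tmul_zero, map_zero]
      | add x y hx hy => simp only [tmul_add, map_add, hx, hy]
      | tmul p c => rfl
  refine (h1 _).trans (Eq.trans ?_ (h2 _).symm)
  rw [← N.coassoc, AddEquiv.symm_apply_apply]

/-- Right colinearity of `Ψ` makes `n ↦ n₀ ⊗ Ψ(n₁)` right colinear. -/
theorem coactRetraction_colinear (N : RightComodule S D) (n : N.carrier) :
    lTensorCoact N.carrier (rhoSCS Φ) (coactRetraction Ψ N n) =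
      map (coactRetraction Ψ N) LinearMap.id (N.coact n) := by
  have h : ∀ y : BTensor S N.carrier D,
      lTensorCoact N.carrier (rhoSCS Φ) (lTensorRetraction Ψ N.carrier y) =
        map (lTensorRetraction Ψ N.carrier) LinearMap.id
          (assoc.symm (map LinearMap.id (comul (R := S) (C := D)).left y)) := by
    intro y
    induction y using induction_on with
    | zero => simp only [map_zero]
    | add x y hx hy => simp only [map_add, hx, hy]
    | tmul n d =>
      change assoc.symm (tmul S n (rhoSCS Φ (retractionBimod Ψ d))) =
        map (lTensorRetraction Ψ N.carrier) LinearMap.id (assoc.symm (tmul S n (comul d)))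
      rw [retraction_rcolinear]
      generalize (comul d : BTensor S D D) = z
      induction z using induction_on with
      | zero => simp only [tmul_zero, map_zero]
      | add x y hx hy => simp only [tmul_add, map_add, hx, hy]
      | tmul p c => rfl
  refine (h (N.coact n)).trans ?_
  rw [← N.coassoc, AddEquiv.symm_apply_apply, map_map]
  rfl

theorem coactRetraction_natural {N N' : RightComodule S D} (f : N ⟶ N') (n : N.carrier) :
    coactRetraction Ψ N' (f.toLin n) = map f.toLin LinearMap.id (coactRetraction Ψ N n) := by
  change map _ _ (N'.coact (f.toLin n)) = map _ _ (map _ _ (N.coact n))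
  rw [f.colinear, map_map, map_map]
  rfl

/-- The cotensor condition characterizes the image of `cotensorIncl`, as `S` preserves the
equalizer. -/
theorem exists_cotensorIncl_eq (hS : PreservesCotensor Φ (Res Φ.base)) (N : RightComodule S D)
    (y : BTensor S N.carrier (SCS Φ))
    (hy : map N.coact LinearMap.id y = assoc.symm (map LinearMap.id (lambdaSCS Φ).left y)) :
    ∃ z, cotensorIncl Φ N z = y := by
  obtain ⟨x, rfl⟩ := assoc.surjective y
  rw [map_coact_assoc, map_lambdaSCS_assoc] at hy
  obtain ⟨z, hz⟩ := ((hS N).2 x).1 (assoc.injective hy)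
  exact ⟨z, congrArg assoc hz⟩

theorem cotensorIncl_injective (hS : PreservesCotensor Φ (Res Φ.base)) (N : RightComodule S D) :
    Function.Injective (cotensorIncl Φ N) := fun _ _ h => (hS N).1 (assoc.injective h)

variable (hS : PreservesCotensor Φ (Res Φ.base))

/-- The factorization of `n ↦ n₀ ⊗ Ψ(n₁)` through `(N □_D (S ⊗_R C)) ⊗_R S`. -/
noncomputable def splittingLin (N : RightComodule S D) :
    N.carrier →ₗ[Sᵐᵒᵖ] BTensor R (cotensor Φ N) (Res Φ.base) :=
  (LinearEquiv.ofInjective _ (cotensorIncl_injective hS N)).symm.toLinearMap.comp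
    ((coactRetraction Ψ N).codRestrict _ fun n =>
      exists_cotensorIncl_eq hS N _ (coactRetraction_equalizes Ψ N n))

theorem cotensorIncl_splittingLin (N : RightComodule S D) (n : N.carrier) :
    cotensorIncl Φ N (splittingLin Ψ hS N n) = coactRetraction Ψ N n :=
  congrArg Subtype.val
    ((LinearEquiv.ofInjective _ (cotensorIncl_injective hS N)).apply_symm_apply _)

theorem splittingLin_counitLin (hΨ : phiHat Φ ≫ Ψ = 𝟙 (bicomoduleSCS Φ)) (N : RightComodule S D)
    (z : BTensor R (cotensor Φ N) (Res Φ.base)) : splittingLin Ψ hS N (counitLin Φ N z) = z := by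
  apply cotensorIncl_injective hS N
  rw [cotensorIncl_splittingLin]
  change map _ _ (N.coact (counitLin Φ N z)) = _
  rw [coact_counitLin, map_map]
  have h : (retractionBimod Ψ).left.comp (phiHatBimod Φ).left = LinearMap.id :=
    LinearMap.ext fun x =>
      congrArg (fun f : bicomoduleSCS Φ ⟶ bicomoduleSCS Φ => f.toBimodHom x) hΨ
  rw [h]
  exact map_id _

variable (hCC : PreservesCotensor Φ (BTensor R C C))

/-- The splitting of the counit at `N` as a colinear map. -/
noncomputable def splittingHom (hΨ : phiHat Φ ≫ Ψ = 𝟙 (bicomoduleSCS Φ)) (N : RightComodule S D) :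
    RightComodule.Hom N (inductionComodule Φ (cotensorComodule Φ hCC N)) where
  toLin := splittingLin Ψ hS N
  colinear n := by
    -- `cotensorIncl` is split over `S`, so that it stays injective after tensoring with `D`.
    apply injective_map_of_leftInverse (P := D) (cotensorIncl Φ N)
      ((splittingLin Ψ hS N).comp (contractRight N.carrier (counitSCS Φ)))
      (splittingLin_counitLin Ψ hS hΨ N)
    have h : (cotensorIncl Φ N).comp (splittingLin Ψ hS N) = coactRetraction Ψ N :=
      LinearMap.ext (cotensorIncl_splittingLin Ψ hS N)
    refine (cotensorIncl_colinear Φ hCC N _).trans (Eq.trans ?_ (map_map _ _ _ _ _).symm)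
    refine (congrArg _ (cotensorIncl_splittingLin Ψ hS N n)).trans ?_
    exact (coactRetraction_colinear Ψ N n).trans
      (congrArg (fun f => map f (LinearMap.id : D →ₗ[S] D) (N.coact n)) h.symm)

/-- The splitting of the counit as a natural transformation. -/
noncomputable def splittingNat (hΨ : phiHat Φ ≫ Ψ = 𝟙 (bicomoduleSCS Φ)) :
    𝟭 (RightComodule S D) ⟶ coinduction Φ hCC ⋙ induction Φ where
  app N := splittingHom Ψ hS hCC hΨ N
  naturality N N' f := RightComodule.hom_ext fun n => by
    apply cotensorIncl_injective hS N'
    refine (cotensorIncl_splittingLin Ψ hS N' (f.toLin n)).trans ?_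
    refine Eq.trans ?_ (cotensorIncl_map Φ f (splittingLin Ψ hS N n)).symm
    rw [cotensorIncl_splittingLin, coactRetraction_natural]

end ofRetraction

/-! ### From a splitting of the counit to a retraction of bicomodules -/

section ofSplitting

/-- The coring `D` as a right comodule over itself. -/
def regularComodule (S D : Type u) [Ring S] [AddCommGroup D] [Module S D] [Module Sᵐᵒᵖ D]
    [SMulCommClass S Sᵐᵒᵖ D] [Coring S D] : RightComodule S D where
  carrier := D
  coact := comul.right
  coassoc := Coring.coassoc
  coact_counit := Coring.comul_counit

/-- The right comodule `D ⊗_S D` with coaction `D ⊗_S Δ`. -/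
def tensorComodule (S D : Type u) [Ring S] [AddCommGroup D] [Module S D] [Module Sᵐᵒᵖ D]
    [SMulCommClass S Sᵐᵒᵖ D] [Coring S D] : RightComodule S D where
  carrier := BTensor S D D
  coact := lTensorCoact D comul
  coassoc := lTensorCoact_coassoc comul Coring.coassoc
  coact_counit := lTensorCoact_counit comul Coring.comul_counit

/-- Left multiplication by `s ∈ S` on `D`. -/
def smulLin (s : S) : D →ₗ[Sᵐᵒᵖ] D where
  toFun d := s • d
  map_add' := smul_add s
  map_smul' r d := smul_comm s r d

/-- Left multiplication by `s ∈ S` on `D` is right colinear. -/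
def smulHom (s : S) : RightComodule.Hom (regularComodule S D) (regularComodule S D) where
  toLin := (smulLin s : D →ₗ[Sᵐᵒᵖ] D)
  colinear d := BimodHom.map_smul (comul (R := S) (C := D)) s d

/-- The map `D → D ⊗_S D`, `d ↦ d' ⊗ d`. -/
def tmulLin (d' : D) : D →ₗ[Sᵐᵒᵖ] BTensor S D D where
  toFun d := tmul S d' d
  map_add' := tmul_add d'
  map_smul' _ _ := rfl

theorem tmulLin_colinear (d' d : D) : lTensorCoact D (comul (R := S)) (tmulLin (S := S) d' d) =
    map (tmulLin d') LinearMap.id (comul (R := S) d) := by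
  change assoc.symm (tmul S d' (comul d)) = _
  generalize (comul d : BTensor S D D) = z
  induction z using induction_on with
  | zero => simp only [tmul_zero, map_zero]
  | add x y hx hy => simp only [tmul_add, map_add, hx, hy]
  | tmul p c => rfl

/-- The map `D → D ⊗_S D`, `d ↦ d' ⊗ d`, is right colinear. -/
def tmulHom (d' : D) : RightComodule.Hom (regularComodule S D) (tensorComodule S D) where
  toLin := tmulLin (D := D) d'
  colinear := tmulLin_colinear (D := D) d'

theorem comul_colinear (d : D) : lTensorCoact D (comul (R := S)) (comul (R := S) d) =
    map comul.right LinearMap.id (comul (R := S) d) := by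
  change assoc.symm (map _ _ (comul d)) = _
  rw [← Coring.coassoc, AddEquiv.symm_apply_apply]

/-- The comultiplication `D → D ⊗_S D` is right colinear. -/
def comulHom (S D : Type u) [Ring S] [AddCommGroup D] [Module S D] [Module Sᵐᵒᵖ D]
    [SMulCommClass S Sᵐᵒᵖ D] [Coring S D] :
    RightComodule.Hom (regularComodule S D) (tensorComodule S D) where
  toLin := (comul (R := S) (C := D)).right
  colinear := comul_colinear (D := D)

/-- The contraction `D ⊗_S (S ⊗_R C ⊗_R S) → S ⊗_R C ⊗_R S`, `d ⊗ x ↦ ε(d) x`, as a map of right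
modules. -/
def counitContract : BTensor S D (SCS Φ) →ₗ[Sᵐᵒᵖ] SCS Φ where
  toFun := contractLeft (SCS Φ) counit
  map_add' := map_add _
  map_smul' := contractLeft_op_smul counit

theorem counitContract_smul (s : S) (y : BTensor S D (SCS Φ)) :
    counitContract Φ (s • y) = s • counitContract Φ y :=
  (contractLeft (SCS Φ) counit).map_smul s y

theorem counitContract_colinear (y : BTensor S D (SCS Φ)) :
    rhoSCS Φ (counitContract Φ y) =
      map (counitContract Φ) LinearMap.id (lTensorCoact D (rhoSCS Φ) y) := by
  induction y using induction_on with
  | zero => simp only [map_zero]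
  | add x y hx hy => simp only [map_add, hx, hy]
  | tmul d p =>
    change rhoSCS Φ (counit (R := S) d • p) =
      map (counitContract Φ) LinearMap.id (assoc.symm (tmul S d (rhoSCS Φ p)))
    rw [BimodHom.map_smul]
    generalize rhoSCS Φ p = z
    induction z using induction_on with
    | zero => simp only [tmul_zero, map_zero, smul_zero]
    | add x y hx hy => simp only [tmul_add, map_add, smul_add, hx, hy]
    | tmul p c => rfl

/-- On elements satisfying the cotensor condition, the coaction of `S ⊗_R C ⊗_R S` is inverse to
contraction with the counit of `D`. -/
theorem lambdaSCS_counitContract (y : BTensor S D (SCS Φ))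
    (hy : map (comul (R := S) (C := D)).right LinearMap.id y =
      assoc.symm (map LinearMap.id (lambdaSCS Φ).left y)) :
    lambdaSCS Φ (counitContract Φ y) = y := by
  have h : ∀ y : BTensor S D (SCS Φ), contractLeft (BTensor S D (SCS Φ)) counit
      (assoc (map (comul (R := S) (C := D)).right LinearMap.id y)) = y := by
    intro y
    induction y using induction_on with
    | zero => simp only [map_zero]
    | add x y hx hy => simp only [map_add, hx, hy]
    | tmul d p =>
      have h1 : ∀ z : BTensor S D D, contractLeft (BTensor S D (SCS Φ)) counit
          (assoc (tmul S z p)) = tmul S (contractLeft D counit z) p := by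
        intro z
        induction z using induction_on with
        | zero => simp only [zero_tmul, map_zero]
        | add x y hx hy => simp only [add_tmul, map_add, hx, hy]
        | tmul a b => rfl
      exact (h1 _).trans (congrArg (fun d => tmul S d p) (Coring.counit_comul d))
  refine (contractLeft_map counit (lambdaSCS Φ).left y).symm.trans ?_
  rw [← assoc.apply_symm_apply (map LinearMap.id (lambdaSCS Φ).left y), ← hy, h]

variable {Φ} {hCC : PreservesCotensor Φ (BTensor R C C)}
  (ν : 𝟭 (RightComodule S D) ⟶ coinduction Φ hCC ⋙ induction Φ)

/-- The component of a natural transformation `id → FG` at `N`, as a linear map. -/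
def appLin (N : RightComodule S D) :
    N.carrier →ₗ[Sᵐᵒᵖ] BTensor R (cotensor Φ N) (Res Φ.base) := (ν.app N).toLin

theorem appLin_colinear (N : RightComodule S D) (n : N.carrier) :
    inductionCoact Φ (cotensorCoact Φ hCC.of_tensor N) (appLin ν N n) =
      map (appLin ν N) LinearMap.id (N.coact n) := (ν.app N).colinear n

/-- The composite `N → (N □_D (S ⊗_R C)) ⊗_R S → N ⊗_S (S ⊗_R C ⊗_R S)`. -/
def appIncl (N : RightComodule S D) : N.carrier →ₗ[Sᵐᵒᵖ] BTensor S N.carrier (SCS Φ) :=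
  (cotensorIncl Φ N).comp (appLin ν N)

theorem appIncl_natural {N N' : RightComodule S D} (f : N ⟶ N') (n : N.carrier) :
    appIncl ν N' (f.toLin n) = map f.toLin LinearMap.id (appIncl ν N n) := by
  have h : appLin ν N' (f.toLin n) =
      map ((ambientMap Φ f).restrict (ambientMap_mem Φ f)) LinearMap.id (appLin ν N n) :=
    congrArg (fun g : N ⟶ (coinduction Φ hCC ⋙ induction Φ).obj N' => g.toLin n) (ν.naturality f)
  exact (congrArg _ h).trans (cotensorIncl_map Φ f _)

theorem appIncl_colinear (N : RightComodule S D) (n : N.carrier) :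
    lTensorCoact N.carrier (rhoSCS Φ) (appIncl ν N n) =
      map (appIncl ν N) LinearMap.id (N.coact n) := by
  refine (cotensorIncl_colinear Φ hCC N (appLin ν N n)).symm.trans ?_
  rw [appLin_colinear, map_map]
  rfl

/-- The map `appIncl` at the comodule `D`. -/
def regularIncl : D →ₗ[Sᵐᵒᵖ] BTensor S D (SCS Φ) := appIncl ν (regularComodule S D)

theorem regularIncl_smul (s : S) (d : D) : regularIncl ν (s • d) = s • regularIncl ν d :=
  appIncl_natural ν (smulHom s) d

/-- The map `appIncl` at the comodule `D ⊗_S D`. -/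
def tensorIncl : BTensor S D D →ₗ[Sᵐᵒᵖ] BTensor S (BTensor S D D) (SCS Φ) :=
  appIncl ν (tensorComodule S D)

theorem tensorIncl_tmul (d' d : D) :
    tensorIncl ν (tmul S d' d) = map (tmulLin d') LinearMap.id (regularIncl ν d) :=
  appIncl_natural ν (tmulHom d') d

theorem tensorIncl_comul (d : D) :
    tensorIncl ν (comul d) = map comul.right LinearMap.id (regularIncl ν d) :=
  appIncl_natural ν (comulHom S D) d

theorem regularIncl_colinear (d : D) : lTensorCoact D (rhoSCS Φ) (regularIncl ν d) =
    map (regularIncl ν) LinearMap.id (comul (R := S) d) :=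
  appIncl_colinear ν (regularComodule S D) d

/-- The map `d ↦ (ε ⊗ id)(regularIncl d)` from `D` to `S ⊗_R C ⊗_R S`. -/
def splittingBimod : BimodHom S S D (SCS Φ) where
  toAddMonoidHom := ((counitContract Φ).comp (regularIncl ν)).toAddMonoidHom
  map_smul' s d := by
    change counitContract Φ (regularIncl ν (s • d)) = s • counitContract Φ (regularIncl ν d)
    rw [regularIncl_smul, counitContract_smul]
  map_op_smul' := ((counitContract Φ).comp (regularIncl ν)).map_smul

theorem splittingBimod_apply (d : D) :
    splittingBimod ν d = counitContract Φ (regularIncl ν d) := rfl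

theorem lambdaSCS_splittingBimod (d : D) : lambdaSCS Φ (splittingBimod ν d) = regularIncl ν d :=
  lambdaSCS_counitContract Φ _
    (cotensorIncl_equalizes Φ (regularComodule S D) (appLin ν (regularComodule S D) d))

/-- Naturality at the colinear maps `d' ⊗ -` determines `tensorIncl` on `D ⊗_S D`; comparing with
naturality at the comultiplication gives left colinearity. -/
theorem splittingBimod_lcolinear (d : D) : lambdaSCS Φ (splittingBimod ν d) =
    map LinearMap.id (splittingBimod ν).left (comul (R := S) d) := by
  -- `q` applies the counit to the middle factor: `(a ⊗ b) ⊗ p ↦ a ε(b) ⊗ p`.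
  let q : BTensor S (BTensor S D D) (SCS Φ) →+ BTensor S D (SCS Φ) :=
    map (contractRight D counit) LinearMap.id
  have h1 : ∀ y, q (map comul.right LinearMap.id y) = y := by
    intro y
    have h : (contractRight D (counit (R := S))).comp comul.right = LinearMap.id :=
      LinearMap.ext Coring.comul_counit
    change map _ _ _ = _
    rw [map_map, h]
    exact map_id y
  have h2 : ∀ (d' : D) (y : BTensor S D (SCS Φ)),
      q (map (tmulLin d') LinearMap.id y) = tmul S d' (counitContract Φ y) := by
    intro d' y
    induction y using induction_on with
    | zero => simp only [map_zero, tmul_zero]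
    | add x y hx hy => simp only [map_add, tmul_add, hx, hy]
    | tmul a b => exact smul_tmul _ _ _
  have h3 : ∀ z : BTensor S D D, q (tensorIncl ν z) =
      map LinearMap.id (splittingBimod ν).left z := by
    intro z
    induction z using induction_on with
    | zero => simp only [map_zero]
    | add x y hx hy => simp only [map_add, hx, hy]
    | tmul a b => exact (congrArg q (tensorIncl_tmul ν a b)).trans (h2 a _)
  rw [lambdaSCS_splittingBimod, ← h3, tensorIncl_comul, h1]

theorem splittingBimod_rcolinear (d : D) : rhoSCS Φ (splittingBimod ν d) =
    map (splittingBimod ν).right LinearMap.id (comul (R := S) d) := by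
  rw [splittingBimod_apply, counitContract_colinear, regularIncl_colinear, map_map]
  rfl

/-- The homomorphism of bicomodules `D → S ⊗_R C ⊗_R S` given by a natural transformation
`id → FG`. -/
def splittingBicomodule : regularBicomodule S D ⟶ bicomoduleSCS Φ :=
  (⟨splittingBimod (D := D) ν, splittingBimod_lcolinear ν, splittingBimod_rcolinear ν⟩ :
    Bicomodule.Hom (regularBicomodule S D) (bicomoduleSCS Φ))

theorem lambdaSC_mem_cotensor (x : SC Φ) :
    lambdaSC Φ x ∈ cotensor Φ (regularComodule S D) := by
  exact (assoc.symm_apply_apply _).symm.trans (congrArg assoc.symm (lambdaSC_coassoc Φ x))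

/-- `Φ̂(p)` is the value of the counit at the element `lambdaSCS p` of `FGD`, so the splitting sends
it back there. -/
theorem regularIncl_phiHat (hν : ∀ N z, appLin ν N (counitLin Φ N z) = z) (p : SCS Φ) :
    regularIncl ν (phiHatBimod Φ p) = lambdaSCS Φ p := by
  induction p using induction_on with
  | zero => simp only [map_zero]
  | add x y hx hy => simp only [map_add, hx, hy]
  | tmul x s =>
    have h := hν (regularComodule S D) (tmul R ⟨lambdaSC Φ x, lambdaSC_mem_cotensor x⟩ s)
    rw [← contractRight_lambdaSCS]
    exact congrArg (cotensorIncl Φ (regularComodule S D)) h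

theorem splittingBimod_phiHat (hν : ∀ N z, appLin ν N (counitLin Φ N z) = z) (p : SCS Φ) :
    splittingBimod ν (phiHatBimod Φ p) = p := by
  rw [splittingBimod_apply, regularIncl_phiHat ν hν]
  exact lambdaSCS_counit Φ p

end ofSplitting

end Main

end Corings

theorem theorem3p21 {R S C D : Type u} [Ring R] [Ring S]
    [AddCommGroup C] [Module R C] [Module Rᵐᵒᵖ C] [SMulCommClass R Rᵐᵒᵖ C] [Corings.Coring R C]
    [AddCommGroup D] [Module S D] [Module Sᵐᵒᵖ D] [SMulCommClass S Sᵐᵒᵖ D] [Corings.Coring S D]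
    (Φ : Corings.CoringHom R S C D)
    (hS : Corings.PreservesCotensor Φ (Corings.Res Φ.base))
    (hCC : Corings.PreservesCotensor Φ (Corings.BTensor R C C)) :
    Corings.NaturallyFull (Corings.coinduction Φ hCC) ↔
      ∃ Ψ : Corings.regularBicomodule S D ⟶ Corings.bicomoduleSCS Φ,
        Corings.phiHat Φ ≫ Ψ = 𝟙 (Corings.bicomoduleSCS Φ) := by
  rw [Corings.naturallyFull_iff_of_adjunction (Corings.inductionAdj Φ hCC)]
  constructor
  · rintro ⟨ν, hν⟩
    refine ⟨Corings.splittingBicomodule ν, ?_⟩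
    apply Corings.Bicomodule.Hom.ext
    refine Corings.BimodHom.ext (Corings.splittingBimod_phiHat ν fun N z => ?_)
    exact congrArg (fun f : Corings.inductionComodule Φ (Corings.cotensorComodule Φ hCC N) ⟶
      Corings.inductionComodule Φ (Corings.cotensorComodule Φ hCC N) => f.toLin z) (hν N)
  · rintro ⟨Ψ, hΨ⟩
    exact ⟨Corings.splittingNat Ψ hS hCC hΨ, fun N =>
      Corings.RightComodule.hom_ext (Corings.splittingLin_counitLin Ψ hS hΨ N)⟩
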